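/- Let $\mathscr F$ be an exact category (in the sense of Quillen) which is Gorenstein: it has enough projective and enough injective objects, and for some $n\ge 0$ every projective object has injective dimension at most $n$ and every injective object has projective dimension at most $n$. Call an object weakly trivial if it has finite projective dimension (equivalently, finite injective dimension). Let $\mathrm{GProj}(\mathscr F)$ be the full subcategory of the objects $X$ with $\mathrm{Ext}^j_{\mathscr F}(X,P)=0$ for all $j>0$ and all projective $P$, and $\mathrm{GInj}(\mathscr F)$ the full subcategory of the objects $X$ with $\mathrm{Ext}^j_{\mathscr F}(I,X)=0$ for all $j>0$ and all injective $I$, both with the conflations (short exact sequences) of $\mathscr F$ whose terms lie in the subcategory. Then $\mathrm{GProj}(\mathscr F)$ and $\mathrm{GInj}(\mathscr F)$ are Frobenius exact categories, and their stable categories (the quotients by the morphisms that factor through projective objects of the respective Frobenius category), with their standard suspension functors and distinguished triangles, are triangle equivalent. More specifically: 1. Every $G\in\mathrm{GProj}(\mathscr F)$ has an approximation sequence, i.e. a conflation $0\to G\xrightarrow{\eta_G}F(G)\to W\to 0$ with $F(G)\in\mathrm{GInj}(\mathscr F)$ and $W$ weakly trivial. For every morphism $f\colon G\to G'$ in $\mathrm{GProj}(\mathscr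 F)$ and all approximation sequences of $G$ and $G'$ there is a morphism $g\colon F(G)\to F(G')$ with $g\,\eta_G=\eta_{G'}f$. 2. There is a triangle equivalence $\underline{\mathrm{GProj}(\mathscr F)}\xrightarrow{\sim}\underline{\mathrm{GInj}(\mathscr F)}$ which, up to a canonical natural isomorphism, sends $G$ to $F(G)$ and the class of $f\colon G\to G'$ to the class of any $g\colon F(G)\to F(G')$ with $g\,\eta_G=\eta_{G'}f$, whichever approximation sequences are chosen. 3. The inverse equivalence is constructed dually: every $Y\in\mathrm{GInj}(\mathscr F)$ has an approximation sequence $0\to W\to K(Y)\xrightarrow{\varepsilon_Y}Y\to 0$ with $K(Y)\in\mathrm{GProj}(\mathscr F)$ and $W$ weakly trivial; for every morphism $g\colon Y\to Y'$ in $\mathrm{GInj}(\mathscr F)$ there is $f\colon K(Y)\to K(Y')$ with $\varepsilon_{Y'}f=g\,\varepsilon_Y$; and, up to a canonical natural isomorphism, the inverse sends $Y$ to $K(Y)$ and the class of $g$ to the class of any such $f$, whichever approximation sequences are chosen. -/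

import Mathlib

open CategoryTheory CategoryTheory.Limits

universe v u

/-- A class of short complexes `A ⟶ B ⟶ D` in a preadditive category, to be thought of as the
conflations (short exact sequences) of an exact structure. The axioms are in
`ConflationClass.IsExactCategory`. -/
structure ConflationClass (C : Type u) [Category.{v} C] [Preadditive C] where
  /-- the short complex is a conflation -/
  Conflation : ShortComplex C → Prop

namespace ConflationClass

section Basic

variable {C : Type u} [Category.{v} C] [Preadditive C] (E : ConflationClass C)

/-- An inflation is a morphism which is the first morphism of a conflation. -/
def Inflation {X Y : C} (i : X ⟶ Y) : Prop :=
  ∃ (Z : C) (p : Y ⟶ Z) (w : i ≫ p = 0), E.Conflation (ShortComplex.mk i p w)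

/-- A deflation is a morphism which is the second morphism of a conflation. -/
def Deflation {Y Z : C} (p : Y ⟶ Z) : Prop :=
  ∃ (X : C) (i : X ⟶ Y) (w : i ≫ p = 0), E.Conflation (ShortComplex.mk i p w)

/-- The axioms of an exact category in the sense of Quillen: the category is additive, conflations
are kernel-cokernel pairs and are closed under isomorphisms, identities are inflations and
deflations, inflations and deflations are closed under composition, inflations have pushouts along
arbitrary morphisms and these are inflations, and dually for deflations. -/
class IsExactCategory : Prop where
  hasFiniteBiproducts : HasFiniteBiproducts C
  kernel : ∀ S : ShortComplex C, E.Conflation S →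
    Nonempty (IsLimit (KernelFork.ofι S.f S.zero))
  cokernel : ∀ S : ShortComplex C, E.Conflation S →
    Nonempty (IsColimit (CokernelCofork.ofπ S.g S.zero))
  of_iso : ∀ S T : ShortComplex C, Nonempty (S ≅ T) → E.Conflation S → E.Conflation T
  inflation_id : ∀ X : C, E.Inflation (𝟙 X)
  deflation_id : ∀ X : C, E.Deflation (𝟙 X)
  inflation_comp : ∀ {X Y Z : C} (i : X ⟶ Y) (j : Y ⟶ Z),
    E.Inflation i → E.Inflation j → E.Inflation (i ≫ j)
  deflation_comp : ∀ {X Y Z : C} (p : X ⟶ Y) (q : Y ⟶ Z),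
    E.Deflation p → E.Deflation q → E.Deflation (p ≫ q)
  pushout : ∀ {A B A' : C} (i : A ⟶ B) (f : A ⟶ A'), E.Inflation i →
    ∃ (B' : C) (f' : B ⟶ B') (i' : A' ⟶ B'), IsPushout i f f' i' ∧ E.Inflation i'
  pullback : ∀ {B D D' : C} (p : B ⟶ D) (f : D' ⟶ D), E.Deflation p →
    ∃ (B' : C) (f' : B' ⟶ B) (p' : B' ⟶ D'), IsPullback f' p' p f ∧ E.Deflation p'

/-- Projective objects: every morphism to the end term of a conflation lifts to the middle term. -/
def IsProjective (P : C) : Prop :=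
  ∀ S : ShortComplex C, E.Conflation S → ∀ f : P ⟶ S.X₃, ∃ g : P ⟶ S.X₂, g ≫ S.g = f

/-- Injective objects: every morphism from the first term of a conflation extends to the middle
term. -/
def IsInjective (I : C) : Prop :=
  ∀ S : ShortComplex C, E.Conflation S → ∀ f : S.X₁ ⟶ I, ∃ g : S.X₂ ⟶ I, S.f ≫ g = f

/-- Every object is the target of a deflation from a projective object. -/
def HasEnoughProjectives : Prop :=
  ∀ X : C, ∃ (P : C) (p : P ⟶ X), E.IsProjective P ∧ E.Deflation p

/-- Every object is the source of an inflation to an injective object. -/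
def HasEnoughInjectives : Prop :=
  ∀ X : C, ∃ (I : C) (i : X ⟶ I), E.IsInjective I ∧ E.Inflation i

/-- `E.ProjDimLE n X`: there is an exact sequence `0 → Pₙ → ⋯ → P₀ → X → 0` (a splicing of
conflations) with all `Pᵢ` projective. -/
inductive ProjDimLE : ℕ → C → Prop
  | zero (X : C) (hX : E.IsProjective X) : ProjDimLE 0 X
  | succ (n : ℕ) (S : ShortComplex C) (hS : E.Conflation S) (hP : E.IsProjective S.X₂)
      (hK : ProjDimLE n S.X₁) : ProjDimLE (n + 1) S.X₃

/-- `E.InjDimLE n X`: there is an exact sequence `0 → X → I⁰ → ⋯ → Iⁿ → 0` (a splicing of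
conflations) with all `Iⁱ` injective. -/
inductive InjDimLE : ℕ → C → Prop
  | zero (X : C) (hX : E.IsInjective X) : InjDimLE 0 X
  | succ (n : ℕ) (S : ShortComplex C) (hS : E.Conflation S) (hI : E.IsInjective S.X₂)
      (hK : InjDimLE n S.X₃) : InjDimLE (n + 1) S.X₁

/-- `n`-Gorenstein: enough projectives and injectives, projectives have injective dimension at most
`n` and injectives have projective dimension at most `n`. -/
structure IsNGorenstein (n : ℕ) : Prop where
  enoughProjectives : E.HasEnoughProjectives
  enoughInjectives : E.HasEnoughInjectives
  injDim_of_projective : ∀ P : C, E.IsProjective P → E.InjDimLE n P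
  projDim_of_injective : ∀ I : C, E.IsInjective I → E.ProjDimLE n I

/-- Gorenstein: `n`-Gorenstein for some `n`. -/
def IsGorenstein : Prop := ∃ n : ℕ, E.IsNGorenstein n

/-- A Frobenius exact category: an exact category with enough projectives and injectives, in which
projective and injective objects coincide. -/
class IsFrobenius : Prop extends E.IsExactCategory where
  enoughProjectives : E.HasEnoughProjectives
  enoughInjectives : E.HasEnoughInjectives
  projective_iff_injective : ∀ X : C, E.IsProjective X ↔ E.IsInjective X

end Basic

section Ext

variable {C : Type u} [Category.{v} C] [Preadditive C] (E : ConflationClass C)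

/-- A conflation `0 → Y → M → X → 0` with prescribed end terms. -/
structure Extension (X Y : C) where
  M : C
  i : Y ⟶ M
  p : M ⟶ X
  w : i ≫ p = 0
  conflation : E.Conflation (ShortComplex.mk i p w)

/-- Yoneda `n`-extensions of `X` by `Y`, i.e. exact sequences
`0 → Y → Mₙ → ⋯ → M₁ → X → 0`, for `n ≥ 1`, as iterated splicings of conflations. -/
inductive YonedaExtension : ℕ → C → C → Type (max u v)
  | single {X Y : C} (e : E.Extension X Y) : YonedaExtension 1 X Y
  | splice {n : ℕ} {X Z Y : C} (e : E.Extension Z Y) (ξ : YonedaExtension n X Z) :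
      YonedaExtension (n + 1) X Y

/-- `ξ.Morphism f ξ'`: there is a morphism of exact sequences from `ξ` to `ξ'` which is the
identity on the right end term `X` and `f : Y ⟶ Y'` on the left end terms. -/
inductive YonedaExtension.Morphism {E : ConflationClass C} :
    ∀ {n : ℕ} {X Y Y' : C}, E.YonedaExtension n X Y → (Y ⟶ Y') → E.YonedaExtension n X Y' → Prop
  | single {X Y Y' : C} (e : E.Extension X Y) (e' : E.Extension X Y') (f : Y ⟶ Y')
      (m : e.M ⟶ e'.M) (hi : e.i ≫ m = f ≫ e'.i) (hp : m ≫ e'.p = e.p) :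
      Morphism (.single e) f (.single e')
  | splice {n : ℕ} {X Z Z' Y Y' : C} (e : E.Extension Z Y) (e' : E.Extension Z' Y')
      (ξ : E.YonedaExtension n X Z) (ξ' : E.YonedaExtension n X Z') (f : Y ⟶ Y') (g : Z ⟶ Z')
      (m : e.M ⟶ e'.M) (hi : e.i ≫ m = f ≫ e'.i) (hp : m ≫ e'.p = e.p ≫ g)
      (h : Morphism ξ g ξ') :
      Morphism (.splice e ξ) f (.splice e' ξ')

/-- The Yoneda Ext `Extⁿ(X, Y)` for `n ≥ 1`, as a set: `n`-extensions modulo the equivalence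
relation generated by the morphisms of extensions which are identities on both end terms. -/
def Ext (n : ℕ) (X Y : C) : Type (max u v) :=
  Quot (fun ξ ξ' : E.YonedaExtension n X Y => ξ.Morphism (𝟙 Y) ξ')

/-- `Extⁿ(X, Y) = 0` for `n ≥ 1`: as `Extⁿ(X, Y)` is a group under Baer sum, it vanishes if and
only if it has at most one element. -/
def ExtVanishes (n : ℕ) (X Y : C) : Prop := Subsingleton (E.Ext n X Y)

/-- Weakly trivial objects: objects of finite projective dimension (which in a Gorenstein exact
category are the same as the objects of finite injective dimension). -/
def WTriv : ObjectProperty C := fun X => ∃ n : ℕ, E.ProjDimLE n X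

/-- Gorenstein projective objects: `Extʲ(X, P) = 0` for all `j > 0` and all projective `P`. -/
def GProj : ObjectProperty C := fun X =>
  ∀ j : ℕ, 0 < j → ∀ P : C, E.IsProjective P → E.ExtVanishes j X P

/-- Gorenstein injective objects: `Extʲ(I, X) = 0` for all `j > 0` and all injective `I`. -/
def GInj : ObjectProperty C := fun X =>
  ∀ j : ℕ, 0 < j → ∀ I : C, E.IsInjective I → E.ExtVanishes j I X

/-- The exact structure induced on a full subcategory: a sequence of the subcategory is a
conflation if it is one in the ambient category. -/
def restrict (P : ObjectProperty C) : ConflationClass P.FullSubcategory where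
  Conflation S := E.Conflation (S.map P.ι)

/-- The category of Gorenstein projective objects with the induced conflations. -/
abbrev gProj : ConflationClass E.GProj.FullSubcategory := E.restrict E.GProj

/-- The category of Gorenstein injective objects with the induced conflations. -/
abbrev gInj : ConflationClass E.GInj.FullSubcategory := E.restrict E.GInj

/-- An approximation sequence `0 → G → F → W → 0` of `G`, with `F` Gorenstein injective and `W`
weakly trivial. -/
structure GInjApprox (G : C) where
  F : E.GInj.FullSubcategory
  W : C
  η : G ⟶ F.obj
  π : F.obj ⟶ W
  w : η ≫ π = 0
  conflation : E.Conflation (ShortComplex.mk η π w)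
  wTriv : E.WTriv W

/-- An approximation sequence `0 → W → K → Y → 0` of `Y`, with `K` Gorenstein projective and `W`
weakly trivial. -/
structure GProjApprox (Y : C) where
  K : E.GProj.FullSubcategory
  W : C
  ι : W ⟶ K.obj
  ε : K.obj ⟶ Y
  w : ι ≫ ε = 0
  conflation : E.Conflation (ShortComplex.mk ι ε w)
  wTriv : E.WTriv W

end Ext

section Stable

variable {C : Type u} [Category.{v} C] [Preadditive C] (E : ConflationClass C)

/-- Two parallel morphisms are stably equal if their difference factors through a projective
object. -/
def stableRel : HomRel C := fun X Y f g =>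
  ∃ (Q : C) (a : X ⟶ Q) (b : Q ⟶ Y), E.IsProjective Q ∧ a ≫ b = f - g

/-- The stable category: the quotient by the morphisms which factor through projective objects. -/
abbrev StableCategory : Type u := CategoryTheory.Quotient E.stableRel

/-- The projection to the stable category. -/
abbrev toStable : C ⥤ E.StableCategory := CategoryTheory.Quotient.functor E.stableRel

lemma stableRel_add [E.IsExactCategory] {X Y : C} (f₁ f₂ g₁ g₂ : X ⟶ Y)
    (h : E.stableRel f₁ f₂) (h' : E.stableRel g₁ g₂) :
    E.stableRel (f₁ + g₁) (f₂ + g₂) := by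
  obtain ⟨Q, a, b, hQ, h⟩ := h
  obtain ⟨Q', a', b', hQ', h'⟩ := h'
  have := IsExactCategory.hasFiniteBiproducts (E := E)
  have : HasBinaryBiproducts C := hasBinaryBiproducts_of_finite_biproducts C
  refine ⟨Q ⊞ Q', biprod.lift a a', biprod.desc b b', ?_, ?_⟩
  · intro S hS f
    obtain ⟨g, hg⟩ := hQ S hS (biprod.inl ≫ f)
    obtain ⟨g', hg'⟩ := hQ' S hS (biprod.inr ≫ f)
    exact ⟨biprod.desc g g', by ext <;> simp [hg, hg']⟩
  · rw [biprod.lift_desc, h, h']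
    abel

lemma stableRel_zero [E.IsExactCategory] (X Y : C) : E.stableRel (0 : X ⟶ Y) 0 := by
  have := IsExactCategory.hasFiniteBiproducts (E := E)
  have hZ : HasZeroObject C := hasZeroObject_of_hasFiniteBiproducts C
  obtain ⟨Z, hZ⟩ := hZ.zero
  exact ⟨Z, 0, 0, fun S hS f => ⟨0, hZ.eq_of_src _ _⟩, by simp⟩

instance [E.IsExactCategory] : Congruence E.stableRel where
  comp_left f g g' := by
    rintro ⟨Q, a, b, hQ, h⟩
    exact ⟨Q, f ≫ a, b, hQ, by rw [Category.assoc, h, Preadditive.comp_sub]⟩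
  comp_right g := by
    rintro ⟨Q, a, b, hQ, h⟩
    exact ⟨Q, a, b ≫ g, hQ, by rw [← Category.assoc, h, Preadditive.sub_comp]⟩
  equivalence :=
    { refl := fun f => by
        obtain ⟨Q, a, b, hQ, h⟩ := E.stableRel_zero _ _
        exact ⟨Q, a, b, hQ, by rw [h]; simp⟩
      symm := by
        rintro f g ⟨Q, a, b, hQ, h⟩
        exact ⟨Q, -a, b, hQ, by rw [Preadditive.neg_comp, h, neg_sub]⟩
      trans := by
        rintro f g k h h'
        obtain ⟨Q, a, b, hQ, h''⟩ := E.stableRel_add _ _ _ _ h h'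
        exact ⟨Q, a, b, hQ, by rw [h'']; abel⟩ }

instance [E.IsExactCategory] : Preadditive E.StableCategory :=
  CategoryTheory.Quotient.preadditive E.stableRel fun _ _ _ _ _ _ => E.stableRel_add _ _ _ _

/-- A choice, for each object `X`, of a conflation `0 → X → I X → T X → 0` with `I X`
injective. -/
structure SuspensionData where
  I : C → C
  T : C → C
  i (X : C) : X ⟶ I X
  p (X : C) : I X ⟶ T X
  w (X : C) : i X ≫ p X = 0
  conflation (X : C) : E.Conflation (ShortComplex.mk (i X) (p X) (w X))
  injective (X : C) : E.IsInjective (I X)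

namespace SuspensionData

variable {E} (S : E.SuspensionData)

/-- The morphism `v : T X ⟶ T Y` is induced by `f : X ⟶ Y` through a morphism of the chosen
conflations. -/
def Induces {X Y : C} (f : X ⟶ Y) (v : S.T X ⟶ S.T Y) : Prop :=
  ∃ u : S.I X ⟶ S.I Y, S.i X ≫ u = f ≫ S.i Y ∧ S.p X ≫ v = u ≫ S.p Y

variable [E.IsFrobenius]

lemma exists_desc {X Z : C} (k : S.I X ⟶ Z) (hk : S.i X ≫ k = 0) : ∃ v, S.p X ≫ v = k := by
  obtain ⟨h⟩ := IsExactCategory.cokernel (E := E) _ (S.conflation X)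
  exact ⟨h.desc (CokernelCofork.ofπ k hk), h.fac _ WalkingParallelPair.one⟩

lemma cancel {X Z : C} {v v' : S.T X ⟶ Z} (h : S.p X ≫ v = S.p X ≫ v') : v = v' := by
  obtain ⟨hc⟩ := IsExactCategory.cokernel (E := E) _ (S.conflation X)
  exact Cofork.IsColimit.hom_ext hc h

lemma exists_induces {X Y : C} (f : X ⟶ Y) : ∃ v, S.Induces f v := by
  obtain ⟨u, hu⟩ := S.injective Y _ (S.conflation X) (f ≫ S.i Y)
  replace hu : S.i X ≫ u = f ≫ S.i Y := hu
  obtain ⟨v, hv⟩ := S.exists_desc (u ≫ S.p Y) (by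
    rw [← Category.assoc, hu, Category.assoc, S.w, comp_zero])
  exact ⟨v, u, hu, hv⟩

lemma Induces.stable {S : E.SuspensionData} {X Y : C} {f f' : X ⟶ Y} {v v' : S.T X ⟶ S.T Y}
    (h : S.Induces f v) (h' : S.Induces f' v') (hf : E.stableRel f f') : E.stableRel v v' := by
  obtain ⟨u, hu, hv⟩ := h
  obtain ⟨u', hu', hv'⟩ := h'
  obtain ⟨Q, a, b, hQ, hab⟩ := hf
  obtain ⟨c, hc⟩ := (IsFrobenius.projective_iff_injective (E := E) Q).1 hQ _ (S.conflation X) a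
  replace hc : S.i X ≫ c = a := hc
  obtain ⟨d, hd⟩ := S.exists_desc (u - u' - c ≫ b ≫ S.i Y) (by
    rw [Preadditive.comp_sub, Preadditive.comp_sub, hu, hu', ← Category.assoc, hc,
      ← Category.assoc, hab, Preadditive.sub_comp, sub_self])
  refine ⟨S.I Y, d, S.p Y, (IsFrobenius.projective_iff_injective (E := E) _).2 (S.injective Y), ?_⟩
  apply S.cancel
  rw [← Category.assoc, hd, Preadditive.comp_sub, hv, hv', Preadditive.sub_comp,
    Preadditive.sub_comp, Category.assoc, Category.assoc, S.w, comp_zero, comp_zero, sub_zero]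

/-- The suspension functor on the stable category of a Frobenius exact category: it sends `X` to
`T X` and the class of `f : X ⟶ Y` to the class of any morphism `T X ⟶ T Y` induced by `f`. -/
noncomputable def suspension : E.StableCategory ⥤ E.StableCategory :=
  CategoryTheory.Quotient.lift E.stableRel
    { obj := fun X => E.toStable.obj (S.T X)
      map := fun f => E.toStable.map (S.exists_induces f).choose
      map_id := fun X => by
        rw [← E.toStable.map_id]
        exact CategoryTheory.Quotient.sound _ (Induces.stable (S.exists_induces (𝟙 X)).choose_spec
          ⟨𝟙 _, by simp, by simp⟩ (Congruence.equivalence.refl _))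
      map_comp := fun {X Y Z} f g => by
        rw [← E.toStable.map_comp]
        refine CategoryTheory.Quotient.sound _ (Induces.stable (S.exists_induces (f ≫ g)).choose_spec
          ?_ (Congruence.equivalence.refl _))
        obtain ⟨u, hu, hv⟩ := (S.exists_induces f).choose_spec
        obtain ⟨u', hu', hv'⟩ := (S.exists_induces g).choose_spec
        refine ⟨u ≫ u', ?_, ?_⟩
        · rw [← Category.assoc, hu, Category.assoc, hu', Category.assoc]
        · rw [← Category.assoc, hv, Category.assoc, hv', Category.assoc] }
    (fun _ _ f f' h => CategoryTheory.Quotient.sound _ (Induces.stable (S.exists_induces f).choose_spec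
      (S.exists_induces f').choose_spec h))

/-- The description of the suspension functor on morphisms. -/
lemma suspension_map_eq {X Y : C} (f : X ⟶ Y) (v : S.T X ⟶ S.T Y) (h : S.Induces f v) :
    S.suspension.map (E.toStable.map f) = E.toStable.map v :=
  CategoryTheory.Quotient.sound _ (Induces.stable (S.exists_induces f).choose_spec h
    (Congruence.equivalence.refl _))

/-- The distinguished triangles `A ⟶ B ⟶ D ⟶ T A` of the stable category of a Frobenius exact
category: those isomorphic to a standard triangle `X ⟶ Y ⟶ Z ⟶ T X`, which arises from a
conflation `0 → X → Y → Z → 0` and a morphism of conflations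
from it to `0 → X → I X → T X → 0` that is the identity on `X`. -/
def Distinguished {A B D : E.StableCategory} (a : A ⟶ B) (b : B ⟶ D)
    (c : D ⟶ S.suspension.obj A) : Prop :=
  ∃ (K : ShortComplex C) (u : K.X₂ ⟶ S.I K.X₁) (v : K.X₃ ⟶ S.T K.X₁)
    (eA : A ≅ E.toStable.obj K.X₁) (eB : B ≅ E.toStable.obj K.X₂)
    (eD : D ≅ E.toStable.obj K.X₃),
    E.Conflation K ∧ K.f ≫ u = S.i K.X₁ ∧ K.g ≫ v = u ≫ S.p K.X₁ ∧
    a ≫ eB.hom = eA.hom ≫ E.toStable.map K.f ∧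
    b ≫ eD.hom = eB.hom ≫ E.toStable.map K.g ∧
    c ≫ S.suspension.map eA.hom = eD.hom ≫ E.toStable.map v

end SuspensionData

end Stable

section Triangle

variable {C : Type*} [Category* C] [Preadditive C] {D : Type*} [Category* D] [Preadditive D]

/-- `F` is a triangle functor between the stable categories of two Frobenius exact categories: it
is additive, and there is a natural isomorphism `φ : F T ≅ T F` which together with `F` takes
distinguished triangles to distinguished triangles. -/
def IsTriangleFunctor {E : ConflationClass C} {E' : ConflationClass D} [E.IsFrobenius]
    [E'.IsFrobenius] (S : E.SuspensionData) (S' : E'.SuspensionData)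
    (F : E.StableCategory ⥤ E'.StableCategory) : Prop :=
  F.Additive ∧ ∃ φ : S.suspension ⋙ F ≅ F ⋙ S'.suspension,
    ∀ {X Y Z : E.StableCategory} (a : X ⟶ Y) (b : Y ⟶ Z) (c : Z ⟶ S.suspension.obj X),
      S.Distinguished a b c →
        S'.Distinguished (F.map a) (F.map b) (F.map c ≫ φ.hom.app X)

end Triangle

end ConflationClass

/-! The proof rests on one reformulation, `gProj_iff`: `X` is Gorenstein projective exactly when all
extensions of `X` by weakly trivial objects split; `gInj_iff` is the dual. Weakly trivial objects
satisfy two-out-of-three in conflations, contain the injectives and form a self-dual class. The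
opposite category is therefore again Gorenstein with the two subcategories exchanged, and half of
the statements follow by duality. An object that is both Gorenstein projective and weakly trivial is
projective. To pass from Yoneda Ext groups to splittings, Ext is computed with projective
resolutions (`extVanishes_iff_extends`) and balanced (`syzygySplits_op_iff`).

The existence of approximations is the substantial point (`IsGorenstein.exists_gProj_cover`).
Dimension shifting shows that `n`-th syzygies are Gorenstein projective. Taking `n` syzygies of an
embedding into an injective object, whose projective dimension is at most `n`, embeds every `n`-th
syzygy into a projective with an `n`-th syzygy as cokernel. Such embeddings turn a cover of a syzygy
of `Z` into a cover of `Z`. Pulling a cover back along an injective hull then embeds Gorenstein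
projectives into projectives, which gives the Frobenius property.

For the comparison, two morphisms in either subcategory are stably equal exactly when they agree
modulo the ideal of morphisms that factor through weakly trivial objects. Modulo that ideal, `η : G
⟶ F(G)` can be cancelled before morphisms into Gorenstein injectives, and morphisms from Gorenstein
projectives to `F(G)` lift along it, uniquely. So `G ↦ F(G)` is a full and faithful functor, and it
is essentially surjective because a cover `K(Y) ⟶ Y` induces a stable isomorphism `F(K(Y)) ≅ Y`. It
respects triangles because the terms of a conflation have approximations that again form a
conflation (`Conf.exists_approx`). -/

namespace ConflationClass

/-! ### Exact categories: duality, base change, splitting of conflations -/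

section ExactBasics

variable {C : Type u} [Category.{v} C] [Preadditive C]

/-- `E.Conf i p`: the morphisms `i` and `p` form a conflation `0 → A → B → D → 0`. -/
def Conf (E : ConflationClass C) {A B D : C} (i : A ⟶ B) (p : B ⟶ D) : Prop :=
  ∃ w : i ≫ p = 0, E.Conflation (ShortComplex.mk i p w)

/-- The opposite of a class of conflations. -/
def op (E : ConflationClass C) : ConflationClass Cᵒᵖ where
  Conflation S := E.Conflation S.unop

variable {E : ConflationClass C}

lemma conf_op_iff {A B D : Cᵒᵖ} {i : A ⟶ B} {p : B ⟶ D} :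
    E.op.Conf i p ↔ E.Conf p.unop i.unop :=
  ⟨fun ⟨w, h⟩ => ⟨by rw [← unop_comp, w, unop_zero], h⟩,
    fun ⟨w, h⟩ => ⟨Quiver.Hom.unop_inj (by rw [unop_comp, w, unop_zero]), h⟩⟩

lemma Conf.op {A B D : C} {i : A ⟶ B} {p : B ⟶ D} (h : E.Conf i p) : E.op.Conf p.op i.op :=
  conf_op_iff.2 h

lemma Conf.unop {A B D : Cᵒᵖ} {i : A ⟶ B} {p : B ⟶ D} (h : E.op.Conf i p) :
    E.Conf p.unop i.unop :=
  conf_op_iff.1 h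

lemma conf_of_conflation {S : ShortComplex C} (h : E.Conflation S) : E.Conf S.f S.g := ⟨S.zero, h⟩

lemma Conf.inflation {A B D : C} {i : A ⟶ B} {p : B ⟶ D} (h : E.Conf i p) : E.Inflation i :=
  ⟨_, p, h.1, h.2⟩

lemma Conf.deflation {A B D : C} {i : A ⟶ B} {p : B ⟶ D} (h : E.Conf i p) : E.Deflation p :=
  ⟨_, i, h.1, h.2⟩

lemma isProjective_iff {P : C} : E.IsProjective P ↔ ∀ ⦃A B D : C⦄ (i : A ⟶ B) (p : B ⟶ D),
    E.Conf i p → ∀ f : P ⟶ D, ∃ g, g ≫ p = f :=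
  ⟨fun h _ _ _ _ _ hc f => h _ hc.2 f, fun h _ hS f => h _ _ (conf_of_conflation hS) f⟩

lemma isInjective_iff {I : C} : E.IsInjective I ↔ ∀ ⦃A B D : C⦄ (i : A ⟶ B) (p : B ⟶ D),
    E.Conf i p → ∀ f : A ⟶ I, ∃ g, i ≫ g = f :=
  ⟨fun h _ _ _ _ _ hc f => h _ hc.2 f, fun h _ hS f => h _ _ (conf_of_conflation hS) f⟩

lemma IsProjective.exists_lift {P : C} (hP : E.IsProjective P) {A B D : C} {i : A ⟶ B}
    {p : B ⟶ D} (h : E.Conf i p) (f : P ⟶ D) : ∃ g, g ≫ p = f :=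
  isProjective_iff.1 hP i p h f

lemma IsInjective.exists_desc {I : C} (hI : E.IsInjective I) {A B D : C} {i : A ⟶ B}
    {p : B ⟶ D} (h : E.Conf i p) (f : A ⟶ I) : ∃ g, i ≫ g = f :=
  isInjective_iff.1 hI i p h f

lemma isProjective_op_iff {X : Cᵒᵖ} : E.op.IsProjective X ↔ E.IsInjective X.unop := by
  rw [isProjective_iff, isInjective_iff]
  constructor
  · intro h A B D i p hc f
    obtain ⟨g, hg⟩ := h _ _ hc.op f.op
    exact ⟨g.unop, by rw [← Quiver.Hom.unop_op f, ← hg]; rfl⟩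
  · intro h A B D i p hc f
    obtain ⟨g, hg⟩ := h _ _ hc.unop f.unop
    exact ⟨g.op, by rw [← Quiver.Hom.op_unop f, ← hg]; rfl⟩

lemma isInjective_op_iff {X : Cᵒᵖ} : E.op.IsInjective X ↔ E.IsProjective X.unop := by
  rw [isProjective_iff, isInjective_iff]
  constructor
  · intro h A B D i p hc f
    obtain ⟨g, hg⟩ := h _ _ hc.op f.op
    exact ⟨g.unop, by rw [← Quiver.Hom.unop_op f, ← hg]; rfl⟩
  · intro h A B D i p hc f
    obtain ⟨g, hg⟩ := h _ _ hc.unop f.unop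
    exact ⟨g.op, by rw [← Quiver.Hom.op_unop f, ← hg]; rfl⟩

lemma IsProjective.of_retract {P Q : C} (hP : E.IsProjective P) {s : Q ⟶ P} {r : P ⟶ Q}
    (h : s ≫ r = 𝟙 Q) : E.IsProjective Q := fun S hS f => by
  obtain ⟨g, hg⟩ := hP S hS (r ≫ f)
  exact ⟨s ≫ g, by rw [Category.assoc, hg, reassoc_of% h]⟩

lemma IsInjective.of_retract {P Q : C} (hP : E.IsInjective P) {s : Q ⟶ P} {r : P ⟶ Q}
    (h : s ≫ r = 𝟙 Q) : E.IsInjective Q := fun S hS f => by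
  obtain ⟨g, hg⟩ := hP S hS (f ≫ s)
  exact ⟨g ≫ r, by rw [reassoc_of% hg, h, Category.comp_id]⟩

lemma isProjective_of_isZero {Z : C} (hZ : IsZero Z) : E.IsProjective Z :=
  fun _ _ _ => ⟨0, hZ.eq_of_src _ _⟩

variable (E) in
/-- `Ext¹(X, Y) = 0`, in the form that all conflations `0 → Y → M → X → 0` split. -/
def Splits (X Y : C) : Prop :=
  ∀ ⦃M : C⦄ (i : Y ⟶ M) (p : M ⟶ X), E.Conf i p → ∃ r, i ≫ r = 𝟙 Y

lemma IsInjective.splits {I : C} (hI : E.IsInjective I) (X : C) : E.Splits X I :=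
  fun _ _ _ h => hI.exists_desc h (𝟙 I)

variable [E.IsExactCategory]

lemma Conf.exists_lift {A B D : C} {i : A ⟶ B} {p : B ⟶ D} (h : E.Conf i p) {X : C}
    (f : X ⟶ B) (hf : f ≫ p = 0) : ∃ g, g ≫ i = f := by
  obtain ⟨hl⟩ := IsExactCategory.kernel (E := E) _ h.2
  exact ⟨hl.lift (KernelFork.ofι f hf), hl.fac _ WalkingParallelPair.zero⟩

lemma Conf.exists_desc {A B D : C} {i : A ⟶ B} {p : B ⟶ D} (h : E.Conf i p) {X : C}
    (f : B ⟶ X) (hf : i ≫ f = 0) : ∃ g, p ≫ g = f := by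
  obtain ⟨hl⟩ := IsExactCategory.cokernel (E := E) _ h.2
  exact ⟨hl.desc (CokernelCofork.ofπ f hf), hl.fac _ WalkingParallelPair.one⟩

lemma Conf.mono {A B D : C} {i : A ⟶ B} {p : B ⟶ D} (h : E.Conf i p) : Mono i := by
  obtain ⟨hl⟩ := IsExactCategory.kernel (E := E) _ h.2
  exact ⟨fun _ _ h => Fork.IsLimit.hom_ext hl h⟩

lemma Conf.epi {A B D : C} {i : A ⟶ B} {p : B ⟶ D} (h : E.Conf i p) : Epi p := by
  obtain ⟨hl⟩ := IsExactCategory.cokernel (E := E) _ h.2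
  exact ⟨fun _ _ h => Cofork.IsColimit.hom_ext hl h⟩

lemma Conf.of_iso {A B D A' B' D' : C} {i : A ⟶ B} {p : B ⟶ D} (h : E.Conf i p)
    {i' : A' ⟶ B'} {p' : B' ⟶ D'} (a : A ≅ A') (b : B ≅ B') (d : D ≅ D')
    (hi : a.hom ≫ i' = i ≫ b.hom) (hp : b.hom ≫ p' = p ≫ d.hom) : E.Conf i' p' := by
  have w : i' ≫ p' = 0 := by
    rw [← cancel_epi a.hom, reassoc_of% hi, hp, reassoc_of% h.1, zero_comp, comp_zero]
  exact ⟨w, IsExactCategory.of_iso _ _ ⟨ShortComplex.isoMk a b d hi hp⟩ h.2⟩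

/-- A monomorphism killed by `p` factors through the kernel `i`; if `i` factors through it too, both
represent the same subobject. -/
lemma Conf.of_kernel {A B D : C} {i : A ⟶ B} {p : B ⟶ D} (h : E.Conf i p) {A' : C}
    {i' : A' ⟶ B} [Mono i'] (w : i' ≫ p = 0) (a : A ⟶ A') (ha : a ≫ i' = i) : E.Conf i' p := by
  obtain ⟨b, hb⟩ := h.exists_lift i' w
  have := h.mono
  exact h.of_iso ⟨a, b, by rw [← cancel_mono i]; simp [ha, hb],
    by rw [← cancel_mono i']; simp [ha, hb]⟩ (Iso.refl _) (Iso.refl _) (by simp [ha]) (by simp)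

/-- Quillen's axioms are self-dual. This is what allows every statement about injectives, cosyzygies
and Gorenstein injectives to be read off from its projective counterpart. -/
instance : E.op.IsExactCategory where
  hasFiniteBiproducts := by
    have := IsExactCategory.hasFiniteBiproducts (E := E)
    exact HasFiniteBiproducts.of_hasFiniteProducts
  kernel S hS := by
    have h : E.Conf S.g.unop S.f.unop := (conf_of_conflation hS).unop
    have := h.epi
    have : Mono S.f := (inferInstance : Mono S.f.unop.op)
    refine ⟨Fork.IsLimit.mk' _ fun s => ?_⟩
    have hs := KernelFork.condition s
    have hd := h.exists_desc s.ι.unop (Quiver.Hom.op_inj hs)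
    exact ⟨hd.choose.op, Quiver.Hom.unop_inj hd.choose_spec, fun {m} hm => by
      rw [← cancel_mono S.f]
      exact hm.trans (Quiver.Hom.unop_inj hd.choose_spec).symm⟩
  cokernel S hS := by
    have h : E.Conf S.g.unop S.f.unop := (conf_of_conflation hS).unop
    have := h.mono
    have : Epi S.g := (inferInstance : Epi S.g.unop.op)
    refine ⟨Cofork.IsColimit.mk' _ fun s => ?_⟩
    have hs := CokernelCofork.condition s
    have hd := h.exists_lift s.π.unop (Quiver.Hom.op_inj hs)
    exact ⟨hd.choose.op, Quiver.Hom.unop_inj hd.choose_spec, fun {m} hm => by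
      rw [← cancel_epi S.g]
      exact hm.trans (Quiver.Hom.unop_inj hd.choose_spec).symm⟩
  of_iso S T e hS := by
    obtain ⟨e⟩ := e
    exact IsExactCategory.of_iso (E := E) _ _ ⟨ShortComplex.unopMap e.inv, ShortComplex.unopMap e.hom,
      ShortComplex.hom_ext _ _
        (congrArg Quiver.Hom.unop (congrArg ShortComplex.Hom.τ₃ e.hom_inv_id))
        (congrArg Quiver.Hom.unop (congrArg ShortComplex.Hom.τ₂ e.hom_inv_id))
        (congrArg Quiver.Hom.unop (congrArg ShortComplex.Hom.τ₁ e.hom_inv_id)),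
      ShortComplex.hom_ext _ _
        (congrArg Quiver.Hom.unop (congrArg ShortComplex.Hom.τ₃ e.inv_hom_id))
        (congrArg Quiver.Hom.unop (congrArg ShortComplex.Hom.τ₂ e.inv_hom_id))
        (congrArg Quiver.Hom.unop (congrArg ShortComplex.Hom.τ₁ e.inv_hom_id))⟩ hS
  inflation_id X := by
    obtain ⟨Z, p, w, h⟩ := IsExactCategory.deflation_id (E := E) X.unop
    exact (Conf.op (E := E) ⟨w, h⟩).inflation
  deflation_id X := by
    obtain ⟨Z, p, w, h⟩ := IsExactCategory.inflation_id (E := E) X.unop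
    exact (Conf.op (E := E) ⟨w, h⟩).deflation
  inflation_comp i j := by
    rintro ⟨Z, p, hi⟩ ⟨Z', q, hj⟩
    obtain ⟨_, _, w, h⟩ := IsExactCategory.deflation_comp (E := E) _ _
      (Conf.unop (E := E) hj).deflation (Conf.unop (E := E) hi).deflation
    exact (Conf.op (E := E) ⟨w, h⟩).inflation
  deflation_comp i j := by
    rintro ⟨Z, p, hi⟩ ⟨Z', q, hj⟩
    obtain ⟨_, _, w, h⟩ := IsExactCategory.inflation_comp (E := E) _ _
      (Conf.unop (E := E) hj).inflation (Conf.unop (E := E) hi).inflation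
    exact (Conf.op (E := E) ⟨w, h⟩).deflation
  pushout i f := by
    rintro ⟨Z, p, hi⟩
    obtain ⟨B, f', p', h, _, _, w, h'⟩ := IsExactCategory.pullback (E := E) _ f.unop
      (Conf.unop (E := E) hi).deflation
    exact ⟨_, f'.op, p'.op, h.op.flip, (Conf.op (E := E) ⟨w, h'⟩).inflation⟩
  pullback p f := by
    rintro ⟨Z, i, hi⟩
    obtain ⟨B, f', p', h, _, _, w, h'⟩ := IsExactCategory.pushout (E := E) _ f.unop
      (Conf.unop (E := E) hi).inflation
    exact ⟨_, f'.op, p'.op, h.op.flip, (Conf.op (E := E) ⟨w, h'⟩).deflation⟩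

/-- The base change of a conflation along a morphism to its end term. -/
lemma Conf.of_isPullback {A B D D' B' : C} {i : A ⟶ B} {p : B ⟶ D} (h : E.Conf i p)
    {f : D' ⟶ D} {f' : B' ⟶ B} {p' : B' ⟶ D'} (sq : IsPullback f' p' p f) :
    ∃ i' : A ⟶ B', E.Conf i' p' ∧ i' ≫ f' = i := by
  -- The axiom only provides some pullback with a deflation. It is transported to the given square,
  -- and its kernel is then compared with the morphism from `A` determined by `(i, 0)`.
  obtain ⟨B₁, f₁, p₁, sq₁, K, k, w, hk⟩ := IsExactCategory.pullback p f h.deflation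
  let e := sq₁.isoIsPullback _ _ sq
  have he : e.hom ≫ p' = p₁ := sq₁.isoIsPullback_hom_snd _ _ sq
  have hc : E.Conf (k ≫ e.hom) p' :=
    Conf.of_iso (E := E) ⟨w, hk⟩ (Iso.refl _) e (Iso.refl _) (by simp) (by simp [he])
  have hi : sq.lift i 0 (by simp [h.1]) ≫ f' = i := sq.lift_fst _ _ _
  have := h.mono
  have : Mono (sq.lift i 0 (by simp [h.1])) := mono_of_mono_fac hi
  obtain ⟨a, ha⟩ := h.exists_lift ((k ≫ e.hom) ≫ f') (by
    rw [Category.assoc, sq.w, ← Category.assoc, hc.1, zero_comp])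
  exact ⟨_, hc.of_kernel (sq.lift_snd _ _ _) a (sq.hom_ext (by simp [ha]) (by simp [he, w])), hi⟩

lemma Conf.exists_pullback {A B D D' : C} {i : A ⟶ B} {p : B ⟶ D} (h : E.Conf i p)
    (f : D' ⟶ D) : ∃ (B' : C) (f' : B' ⟶ B) (p' : B' ⟶ D') (i' : A ⟶ B'),
      IsPullback f' p' p f ∧ E.Conf i' p' ∧ i' ≫ f' = i := by
  obtain ⟨B', f', p', sq, -⟩ := IsExactCategory.pullback p f h.deflation
  obtain ⟨i', h'⟩ := h.of_isPullback sq
  exact ⟨B', f', p', i', sq, h'⟩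

/-- The cobase change of a conflation along a morphism from its first term. -/
lemma Conf.of_isPushout {A B D A' B' : C} {i : A ⟶ B} {p : B ⟶ D} (h : E.Conf i p)
    {f : A ⟶ A'} {f' : B ⟶ B'} {i' : A' ⟶ B'} (sq : IsPushout i f f' i') :
    ∃ p' : B' ⟶ D, E.Conf i' p' ∧ f' ≫ p' = p := by
  obtain ⟨p', hc, hp⟩ := h.op.of_isPullback sq.op.flip
  exact ⟨p'.unop, hc.unop, by rw [← Quiver.Hom.unop_op p, ← hp]; rfl⟩

lemma Conf.exists_pushout {A B D A' : C} {i : A ⟶ B} {p : B ⟶ D} (h : E.Conf i p)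
    (f : A ⟶ A') : ∃ (B' : C) (f' : B ⟶ B') (i' : A' ⟶ B') (p' : B' ⟶ D),
      IsPushout i f f' i' ∧ E.Conf i' p' ∧ f' ≫ p' = p := by
  obtain ⟨B', f', p', sq, -⟩ := IsExactCategory.pushout i f h.inflation
  obtain ⟨i', h'⟩ := h.of_isPushout sq
  exact ⟨B', f', p', i', sq, h'⟩

/-- The kernel of the composite of two deflations. -/
lemma Conf.exists_comp_deflation {K₁ X Y K₂ Z : C} {a : K₁ ⟶ X} {q : X ⟶ Y} {b : K₂ ⟶ Y}
    {p : Y ⟶ Z} (h₁ : E.Conf a q) (h₂ : E.Conf b p) :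
    ∃ (K : C) (k : K ⟶ X) (c : K₁ ⟶ K) (d : K ⟶ K₂), E.Conf k (q ≫ p) ∧ E.Conf c d ∧
      c ≫ k = a ∧ IsPullback k d q b := by
  obtain ⟨K, k, d, c, sq, hc, hk⟩ := h₁.exists_pullback b
  obtain ⟨L, l, w, hl⟩ := IsExactCategory.deflation_comp q p h₁.deflation h₂.deflation
  have hl : E.Conf l (q ≫ p) := ⟨w, hl⟩
  have := h₂.mono
  have : Mono k := sq.flip.mono_snd_of_mono
  refine ⟨K, k, c, d, ?_, hc, hk, sq⟩
  obtain ⟨m, hm⟩ := h₂.exists_lift (l ≫ q) (by rw [Category.assoc, w])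
  exact hl.of_kernel (by rw [reassoc_of% sq.w, h₂.1, comp_zero]) (sq.lift l m hm.symm)
    (sq.lift_fst _ _ _)

/-- The cokernel of the composite of two inflations. -/
lemma Conf.exists_comp_inflation {X Y C₁ Z C₂ : C} {a : X ⟶ Y} {q : Y ⟶ C₁} {b : Y ⟶ Z}
    {p : Z ⟶ C₂} (h₁ : E.Conf a q) (h₂ : E.Conf b p) :
    ∃ (K : C) (r : Z ⟶ K) (c : C₁ ⟶ K) (d : K ⟶ C₂), E.Conf (a ≫ b) r ∧ E.Conf c d ∧
      r ≫ d = p ∧ IsPushout b q r c := by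
  obtain ⟨K, k, c, d, hk, hc, h, sq⟩ := h₂.op.exists_comp_deflation h₁.op
  exact ⟨K.unop, k.unop, d.unop, c.unop, hk.unop, hc.unop, congrArg Quiver.Hom.unop h,
    sq.unop.flip⟩

lemma Conf.exists_retraction_of_section {A B D : C} {i : A ⟶ B} {p : B ⟶ D} (h : E.Conf i p)
    {s : D ⟶ B} (hs : s ≫ p = 𝟙 D) :
    ∃ r : B ⟶ A, i ≫ r = 𝟙 A ∧ s ≫ r = 0 ∧ r ≫ i + p ≫ s = 𝟙 B := by
  obtain ⟨r, hr⟩ := h.exists_lift (𝟙 B - p ≫ s) (by simp [hs])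
  have := h.mono
  refine ⟨r, ?_, ?_, by rw [hr]; simp⟩
  · rw [← cancel_mono i, Category.assoc, hr]
    simp [reassoc_of% h.1]
  · rw [← cancel_mono i, Category.assoc, hr]
    simp [reassoc_of% hs]

lemma Conf.exists_section_of_retraction {A B D : C} {i : A ⟶ B} {p : B ⟶ D} (h : E.Conf i p)
    {r : B ⟶ A} (hr : i ≫ r = 𝟙 A) :
    ∃ s : D ⟶ B, s ≫ p = 𝟙 D ∧ s ≫ r = 0 ∧ r ≫ i + p ≫ s = 𝟙 B := by
  obtain ⟨s, hs⟩ := h.exists_desc (𝟙 B - r ≫ i) (by simp [reassoc_of% hr])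
  have := h.epi
  refine ⟨s, ?_, ?_, by rw [hs]; simp⟩
  · rw [← cancel_epi p, reassoc_of% hs]
    simp [h.1]
  · rw [← cancel_epi p, reassoc_of% hs]
    simp [hr]

/-- A split conflation can be read backwards. -/
lemma Conf.swap_of_section {A B D : C} {i : A ⟶ B} {p : B ⟶ D} (h : E.Conf i p)
    {s : D ⟶ B} (hs : s ≫ p = 𝟙 D) : ∃ r : B ⟶ A, i ≫ r = 𝟙 A ∧ E.Conf s r := by
  obtain ⟨r, hr, hsr, hsum⟩ := h.exists_retraction_of_section hs
  have hm : ∀ {X : C} (g : X ⟶ B), g ≫ r = 0 → g ≫ p = 0 → g = 0 := fun g h₁ h₂ => by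
    rw [← Category.comp_id g, ← hsum, Preadditive.comp_add, reassoc_of% h₁, reassoc_of% h₂]
    simp
  refine ⟨r, hr, ?_⟩
  -- `B` is the product of `A` and `D`, so `r` is the base change of `D ⟶ 0` along `A ⟶ 0`
  obtain ⟨W, j, wj, hj⟩ := IsExactCategory.inflation_id (E := E) D
  have hj : E.Conf (𝟙 D) j := ⟨wj, hj⟩
  have hj₀ : j = 0 := by simpa using wj
  have hW : IsZero W := by
    have := hj.epi
    rw [IsZero.iff_id_eq_zero, ← cancel_epi j]
    simp [hj₀]
  have sq : IsPullback p r j (0 : A ⟶ W) :=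
    ⟨⟨hW.eq_of_tgt _ _⟩, ⟨PullbackCone.IsLimit.mk _ (fun t => t.fst ≫ s + t.snd ≫ i)
      (fun t => by simp [hs, h.1]) (fun t => by simp [hsr, hr])
      (fun t m h₁ h₂ => by
        rw [← sub_eq_zero]
        exact hm _ (by simp [h₂, hsr, hr]) (by simp [h₁, hs, h.1]))⟩⟩
  obtain ⟨i', hc, hi'⟩ := hj.of_isPullback sq
  have : i' = s := by
    rw [← sub_eq_zero]
    exact hm _ (by simp [hc.1, hsr]) (by simp [hi', hs])
  exact this ▸ hc

variable (E) in
/-- There is a zero object `0` and a conflation `0 → 0 → X → X → 0`. -/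
lemma exists_conf_zero_id (X : C) : ∃ (Z : C) (i : Z ⟶ X), IsZero Z ∧ E.Conf i (𝟙 X) := by
  obtain ⟨K, z, w₁, h₁⟩ := IsExactCategory.deflation_id (E := E) X
  have h₁ : E.Conf z (𝟙 X) := ⟨w₁, h₁⟩
  have hz : z = 0 := by simpa using w₁
  have := h₁.mono
  exact ⟨K, z, by rw [IsZero.iff_id_eq_zero, ← cancel_mono z]; simp [hz], h₁⟩

lemma conf_zero_id {Z : C} (hZ : IsZero Z) {X Y : C} (e : X ≅ Y) :
    E.Conf (0 : Z ⟶ X) e.hom := by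
  obtain ⟨Z', i, hZ', h⟩ := E.exists_conf_zero_id X
  exact h.of_iso (hZ'.iso hZ) (Iso.refl _) e (by simp [hZ'.eq_of_src i 0]) (by simp)

lemma conf_id_zero {Z : C} (hZ : IsZero Z) {X Y : C} (e : X ≅ Y) :
    E.Conf e.hom (0 : Y ⟶ Z) := by
  simpa using (conf_zero_id (E := E.op) (Z := .op Z) hZ.op e.op).unop

lemma conf_biprod [HasBinaryBiproducts C] (X Y : C) :
    E.Conf (biprod.inl : X ⟶ X ⊞ Y) biprod.snd := by
  obtain ⟨Z, i, hZ, h⟩ := E.exists_conf_zero_id X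
  have h := conf_id_zero (E := E) hZ (Iso.refl X)
  have sq : IsPullback (biprod.fst : X ⊞ Y ⟶ X) biprod.snd (0 : X ⟶ Z) (0 : Y ⟶ Z) :=
    ⟨⟨hZ.eq_of_tgt _ _⟩, ⟨PullbackCone.IsLimit.mk _ (fun t => biprod.lift t.fst t.snd)
      (fun t => by simp) (fun t => by simp)
      (fun t m h₁ h₂ => by ext <;> simp [h₁, h₂])⟩⟩
  obtain ⟨i', hc, hi'⟩ := h.of_isPullback sq
  have : i' = biprod.inl := by
    ext
    · simpa using hi'
    · simpa using hc.1
  exact this ▸ hc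

lemma IsProjective.of_conf {A B D : C} {i : A ⟶ B} {p : B ⟶ D} (h : E.Conf i p)
    (hA : E.IsProjective A) (hD : E.IsProjective D) : E.IsProjective B := fun S hS f => by
  obtain ⟨s, hs⟩ := hD.exists_lift h (𝟙 D)
  obtain ⟨r, -, -, hr⟩ := h.exists_retraction_of_section hs
  obtain ⟨g, hg⟩ := hA S hS (i ≫ f)
  obtain ⟨k, hk⟩ := hD S hS (s ≫ f)
  refine ⟨r ≫ g + p ≫ k, ?_⟩
  rw [Preadditive.add_comp, Category.assoc, Category.assoc, hg, hk, ← Category.assoc,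
    ← Category.assoc, ← Preadditive.add_comp, hr, Category.id_comp]

lemma Splits.exists_section {X Y M : C} (hs : E.Splits X Y) {i : Y ⟶ M} {p : M ⟶ X}
    (h : E.Conf i p) : ∃ s, s ≫ p = 𝟙 X := by
  obtain ⟨r, hr⟩ := hs i p h
  obtain ⟨s, hs, -⟩ := h.exists_section_of_retraction hr
  exact ⟨s, hs⟩

/-- A retraction of the inflation exists if and only if a section of the deflation does, so the
asymmetric definition of `Splits` is self-dual. -/
lemma splits_op_iff {X Y : Cᵒᵖ} : E.op.Splits X Y ↔ E.Splits Y.unop X.unop := by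
  constructor
  · intro hs M i p h
    obtain ⟨s, hs⟩ := Splits.exists_section hs h.op
    exact ⟨s.unop, congrArg Quiver.Hom.unop hs⟩
  · intro hs M i p h
    obtain ⟨s, hs⟩ := Splits.exists_section hs h.unop
    exact ⟨s.op, congrArg Quiver.Hom.op hs⟩

/-- Morphisms extend along an inflation if the extensions of the cokernel by the target split. -/
lemma Splits.exists_extension {A B D Y : C} (hs : E.Splits D Y) {i : A ⟶ B} {p : B ⟶ D}
    (h : E.Conf i p) (f : A ⟶ Y) : ∃ g, i ≫ g = f := by
  obtain ⟨B', f', i', p', sq, hc, -⟩ := h.exists_pushout f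
  obtain ⟨r, hr⟩ := hs i' p' hc
  exact ⟨f' ≫ r, by rw [reassoc_of% sq.w, hr, Category.comp_id]⟩

/-- Morphisms lift along a deflation if the extensions of the source by the kernel split. -/
lemma Splits.exists_lift {A B D X : C} (hs : E.Splits X A) {i : A ⟶ B} {p : B ⟶ D}
    (h : E.Conf i p) (f : X ⟶ D) : ∃ g, g ≫ p = f := by
  obtain ⟨g, hg⟩ := Splits.exists_extension (splits_op_iff (X := .op A) (Y := .op X) |>.2 hs)
    h.op f.op
  exact ⟨g.unop, congrArg Quiver.Hom.unop hg⟩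

lemma IsProjective.splits {P : C} (hP : E.IsProjective P) (Y : C) : E.Splits P Y :=
  fun _ _ _ h => by
    obtain ⟨s, hs⟩ := hP.exists_lift h (𝟙 P)
    obtain ⟨r, hr, -⟩ := h.exists_retraction_of_section hs
    exact ⟨r, hr⟩

/-- `Ext¹(X, Y)` vanishes if all morphisms from a first syzygy of `X` to `Y` extend. -/
lemma splits_of_extension {K P X Y : C} {i : K ⟶ P} {p : P ⟶ X} (h : E.Conf i p)
    (hP : E.IsProjective P) (H : ∀ f : K ⟶ Y, ∃ g, i ≫ g = f) : E.Splits X Y :=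
  fun M j q hc => by
    obtain ⟨m, hm⟩ := hP.exists_lift hc p
    obtain ⟨a, ha⟩ := hc.exists_lift (i ≫ m) (by rw [Category.assoc, hm, h.1])
    obtain ⟨b, hb⟩ := H a
    obtain ⟨s, hs⟩ := h.exists_desc (m - b ≫ j) (by
      rw [Preadditive.comp_sub, reassoc_of% hb, ha, sub_self])
    have := h.epi
    obtain ⟨r, hr, -⟩ := hc.exists_retraction_of_section (s := s) (by
      rw [← cancel_epi p, reassoc_of% hs]
      simp [hm, hc.1])
    exact ⟨r, hr⟩

/-- `Ext¹(X, Y)` vanishes if all morphisms from `X` to a first cosyzygy of `Y` lift. -/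
lemma splits_of_lift {L I X Y : C} {i : Y ⟶ I} {p : I ⟶ L} (h : E.Conf i p)
    (hI : E.IsInjective I) (H : ∀ f : X ⟶ L, ∃ g, g ≫ p = f) : E.Splits X Y :=
  splits_op_iff (X := .op Y) (Y := .op X) |>.1 <|
    splits_of_extension h.op (isProjective_op_iff.2 hI) fun f => by
      obtain ⟨g, hg⟩ := H f.unop
      exact ⟨g.op, congrArg Quiver.Hom.op hg⟩

/-- Restrict the extension `M` of `B` to `A`, giving `K` with cokernel `D` in `M`. A retraction of
`Y ⟶ K` exists because `Ext¹(A, Y) = 0` and extends to `M` because `Ext¹(D, Y) = 0`. -/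
lemma Splits.of_conf_left {A B D Y : C} {i : A ⟶ B} {p : B ⟶ D} (h : E.Conf i p)
    (hA : E.Splits A Y) (hD : E.Splits D Y) : E.Splits B Y := fun M j q hc => by
  obtain ⟨K, k, c, d, hk, hcd, hck, sq⟩ := hc.exists_comp_deflation h
  obtain ⟨r, hr⟩ := hA c d hcd
  obtain ⟨r', hr'⟩ := hD.exists_extension hk r
  exact ⟨r', by rw [← hck, Category.assoc, hr', hr]⟩

/-- Dimension shifting: `Ext¹(ΩX, Y) = Ext¹(X, ΣY)`. -/
lemma splits_syzygy_iff {K P X Y I L : C} {i : K ⟶ P} {p : P ⟶ X} {j : Y ⟶ I} {q : I ⟶ L}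
    (h : E.Conf i p) (hP : E.IsProjective P) (h' : E.Conf j q) (hI : E.IsInjective I) :
    E.Splits K Y ↔ E.Splits X L := by
  constructor
  · refine fun hs => splits_of_extension h hP fun f => ?_
    obtain ⟨g, hg⟩ := hs.exists_lift h' f
    obtain ⟨g', hg'⟩ := hI.exists_desc h g
    exact ⟨g' ≫ q, by rw [reassoc_of% hg', hg]⟩
  · refine fun hs => splits_of_lift h' hI fun f => ?_
    obtain ⟨g, hg⟩ := hs.exists_extension h f
    obtain ⟨g', hg'⟩ := hP.exists_lift h' g
    exact ⟨i ≫ g', by rw [Category.assoc, hg', hg]⟩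

end ExactBasics

/-! ### Projective and injective dimension, weakly trivial objects -/

section Dimension

variable {C : Type u} [Category.{v} C] [Preadditive C] {E : ConflationClass C}

lemma Conf.projDimLE_succ {K P X : C} {i : K ⟶ P} {p : P ⟶ X} (h : E.Conf i p)
    (hP : E.IsProjective P) {n : ℕ} (hK : E.ProjDimLE n K) : E.ProjDimLE (n + 1) X :=
  ProjDimLE.succ n _ h.2 hP hK

lemma Conf.injDimLE_succ {L I X : C} {i : X ⟶ I} {p : I ⟶ L} (h : E.Conf i p)
    (hI : E.IsInjective I) {n : ℕ} (hL : E.InjDimLE n L) : E.InjDimLE (n + 1) X :=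
  InjDimLE.succ n (ShortComplex.mk i p h.1) h.2 hI hL

lemma ProjDimLE.exists_conf {n : ℕ} {X : C} (h : E.ProjDimLE (n + 1) X) :
    ∃ (K P : C) (i : K ⟶ P) (p : P ⟶ X), E.Conf i p ∧ E.IsProjective P ∧ E.ProjDimLE n K := by
  cases h with
  | succ _ S hS hP hK => exact ⟨_, _, _, _, conf_of_conflation hS, hP, hK⟩

lemma projDimLE_zero_iff {X : C} : E.ProjDimLE 0 X ↔ E.IsProjective X :=
  ⟨fun h => by cases h with | zero _ hX => exact hX, ProjDimLE.zero X⟩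

lemma projDimLE_op_iff {n : ℕ} {X : Cᵒᵖ} : E.op.ProjDimLE n X ↔ E.InjDimLE n X.unop := by
  constructor
  · intro h
    induction h with
    | zero X hX => exact .zero _ (isProjective_op_iff.1 hX)
    | succ n S hS hP _ ih =>
      exact (conf_of_conflation hS).unop.injDimLE_succ (isProjective_op_iff.1 hP) ih
  · generalize hY : X.unop = Y
    intro h
    induction h generalizing X with
    | zero Y h => exact .zero _ (isProjective_op_iff.2 (hY ▸ h))
    | succ n S hS hI _ ih =>
      obtain rfl : X = .op S.X₁ := congrArg Opposite.op hY
      exact (conf_of_conflation hS).op.projDimLE_succ (isProjective_op_iff.2 hI) (ih rfl)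

lemma injDimLE_op_iff {n : ℕ} {X : Cᵒᵖ} : E.op.InjDimLE n X ↔ E.ProjDimLE n X.unop := by
  constructor
  · intro h
    induction h with
    | zero X hX => exact .zero _ (isInjective_op_iff.1 hX)
    | succ n S hS hI _ ih =>
      exact (conf_of_conflation hS).unop.projDimLE_succ (isInjective_op_iff.1 hI) ih
  · generalize hY : X.unop = Y
    intro h
    induction h generalizing X with
    | zero Y h => exact .zero _ (isInjective_op_iff.2 (hY ▸ h))
    | succ n S hS hP _ ih =>
      obtain rfl : X = .op S.X₃ := congrArg Opposite.op hY
      exact (conf_of_conflation hS).op.injDimLE_succ (isInjective_op_iff.2 hP) (ih rfl)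

lemma IsProjective.wTriv {P : C} (hP : E.IsProjective P) : E.WTriv P := ⟨0, .zero P hP⟩

lemma wTriv_of_isZero {Z : C} (hZ : IsZero Z) : E.WTriv Z := (isProjective_of_isZero hZ).wTriv

lemma IsGorenstein.op (hE : E.IsGorenstein) : E.op.IsGorenstein := by
  obtain ⟨n, hE⟩ := hE
  refine ⟨n, fun X => ?_, fun X => ?_, fun P hP => ?_, fun I hI => ?_⟩
  · obtain ⟨I, i, hI, Z, p, h⟩ := hE.enoughInjectives X.unop
    exact ⟨.op I, i.op, isProjective_op_iff.2 hI, (Conf.op (E := E) h).deflation⟩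
  · obtain ⟨P, p, hP, Z, i, h⟩ := hE.enoughProjectives X.unop
    exact ⟨.op P, p.op, isInjective_op_iff.2 hP, (Conf.op (E := E) h).inflation⟩
  · exact injDimLE_op_iff.2 (hE.projDim_of_injective _ (isProjective_op_iff.1 hP))
  · exact projDimLE_op_iff.2 (hE.injDim_of_projective _ (isInjective_op_iff.1 hI))

lemma IsGorenstein.enoughProjectives (hE : E.IsGorenstein) (X : C) :
    ∃ (K P : C) (i : K ⟶ P) (p : P ⟶ X), E.Conf i p ∧ E.IsProjective P := by
  obtain ⟨n, hE⟩ := hE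
  obtain ⟨P, p, hP, K, i, h⟩ := hE.enoughProjectives X
  exact ⟨K, P, i, p, h, hP⟩

lemma IsGorenstein.enoughInjectives (hE : E.IsGorenstein) (X : C) :
    ∃ (I L : C) (i : X ⟶ I) (p : I ⟶ L), E.Conf i p ∧ E.IsInjective I := by
  obtain ⟨n, hE⟩ := hE
  obtain ⟨P, p, hP, K, i, h⟩ := hE.enoughInjectives X
  exact ⟨P, K, p, i, h, hP⟩

lemma IsGorenstein.wTriv_of_isInjective (hE : E.IsGorenstein) {I : C} (hI : E.IsInjective I) :
    E.WTriv I := by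
  obtain ⟨n, hE⟩ := hE
  exact ⟨n, hE.projDim_of_injective I hI⟩

variable [E.IsExactCategory]

lemma ProjDimLE.succ_le {n : ℕ} {X : C} (h : E.ProjDimLE n X) : E.ProjDimLE (n + 1) X := by
  induction h with
  | zero X hX =>
    obtain ⟨Z, i, hZ, hc⟩ := E.exists_conf_zero_id X
    exact hc.projDimLE_succ hX (.zero _ (isProjective_of_isZero hZ))
  | succ n S hS hP _ ih => exact .succ _ S hS hP ih

lemma ProjDimLE.mono {n m : ℕ} (hnm : n ≤ m) {X : C} (h : E.ProjDimLE n X) :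
    E.ProjDimLE m X := by
  induction hnm with
  | refl => exact h
  | step _ ih => exact ih.succ_le

lemma WTriv.exists_conf {X : C} (h : E.WTriv X) :
    ∃ (K P : C) (i : K ⟶ P) (p : P ⟶ X), E.Conf i p ∧ E.IsProjective P ∧ E.WTriv K := by
  obtain ⟨n, h⟩ := h
  obtain ⟨K, P, i, p, hc, hP, hK⟩ := h.succ_le.exists_conf
  exact ⟨K, P, i, p, hc, hP, n, hK⟩

/-- The horseshoe lemma. -/
lemma Conf.horseshoe {A B D KA PA KD PD : C} {i : A ⟶ B} {p : B ⟶ D} (h : E.Conf i p)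
    {a : KA ⟶ PA} {α : PA ⟶ A} (hA : E.Conf a α) (hPA : E.IsProjective PA)
    {d : KD ⟶ PD} {δ : PD ⟶ D} (hD : E.Conf d δ) (hPD : E.IsProjective PD) :
    ∃ (KB PB : C) (b : KB ⟶ PB) (β : PB ⟶ B) (c : KA ⟶ KB) (e : KB ⟶ KD),
      E.Conf b β ∧ E.IsProjective PB ∧ E.Conf c e := by
  obtain ⟨B₁, f, q, j, sq, hj, -⟩ := h.exists_pullback δ
  obtain ⟨s, hs⟩ := hPD.exists_lift hj (𝟙 PD)
  obtain ⟨r, -, hr⟩ := hj.swap_of_section hs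
  obtain ⟨d', hd', -⟩ := hD.of_isPullback sq.flip
  obtain ⟨PB, g, t, a', sq', ha', -⟩ := hA.exists_pullback r
  obtain ⟨s', hs', -⟩ := hr.of_isPullback sq'.flip
  obtain ⟨KB, b, c, e, hb, hc, -⟩ := ha'.exists_comp_deflation hd'
  exact ⟨KB, PB, b, _, c, e, hb, .of_conf hs' hPD hPA, hc⟩

lemma ProjDimLE.of_conf {n : ℕ} {A B D : C} {i : A ⟶ B} {p : B ⟶ D} (h : E.Conf i p)
    (hA : E.ProjDimLE n A) (hD : E.ProjDimLE n D) : E.ProjDimLE n B := by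
  induction n generalizing A B D with
  | zero =>
    rw [projDimLE_zero_iff] at *
    exact .of_conf h hA hD
  | succ n ih =>
    obtain ⟨KA, PA, a, α, ha, hPA, hKA⟩ := hA.exists_conf
    obtain ⟨KD, PD, d, δ, hd, hPD, hKD⟩ := hD.exists_conf
    obtain ⟨KB, PB, b, β, c, e, hb, hPB, hc⟩ := h.horseshoe ha hPA hd hPD
    exact hb.projDimLE_succ hPB (ih hc hKA hKD)

/-- The projective dimension does not grow when a projective quotient is split off. -/
lemma ProjDimLE.of_conf_projective {n : ℕ} {A B P : C} {i : A ⟶ B} {p : B ⟶ P}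
    (h : E.Conf i p) (hP : E.IsProjective P) (hB : E.ProjDimLE n B) : E.ProjDimLE n A := by
  have key : ∀ {A B : C} {i : A ⟶ B} {p : B ⟶ P}, E.Conf i p → E.IsProjective B →
      E.IsProjective A := fun h hB => by
    obtain ⟨s, hs⟩ := hP.exists_lift h (𝟙 P)
    obtain ⟨r, hr, -⟩ := h.exists_retraction_of_section hs
    exact hB.of_retract hr
  cases n with
  | zero =>
    rw [projDimLE_zero_iff] at *
    exact key h hB
  | succ n =>
    obtain ⟨K, Q, a, α, ha, hQ, hK⟩ := hB.exists_conf
    obtain ⟨L, b, c, e, hb, hc, -⟩ := ha.exists_comp_deflation h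
    exact hc.projDimLE_succ (key hb hQ) hK

/-- Syzygies of an object of projective dimension at most `n + 1` have projective dimension at
most `n`. -/
lemma Conf.projDimLE {n : ℕ} {K P X : C} {i : K ⟶ P} {p : P ⟶ X} (h : E.Conf i p)
    (hP : E.IsProjective P) (hX : E.ProjDimLE (n + 1) X) : E.ProjDimLE n K := by
  obtain ⟨K₀, P₀, a, α, ha, hP₀, hK₀⟩ := hX.exists_conf
  -- Schanuel's argument: `Q` is an extension of `P` by `K₀` and also of `P₀` by `K`.
  obtain ⟨Q, f, q, j, sq, hj, -⟩ := ha.exists_pullback p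
  obtain ⟨j', hj', -⟩ := h.of_isPullback sq.flip
  have hP' : E.ProjDimLE n P := ProjDimLE.mono (Nat.zero_le n) (.zero P hP)
  exact .of_conf_projective hj' hP₀ (.of_conf hj hK₀ hP')

lemma WTriv.of_conf₂ {A B D : C} {i : A ⟶ B} {p : B ⟶ D} (h : E.Conf i p)
    (hA : E.WTriv A) (hD : E.WTriv D) : E.WTriv B := by
  obtain ⟨n, hn⟩ := hA
  obtain ⟨m, hm⟩ := hD
  exact ⟨max n m, .of_conf h (hn.mono (le_max_left _ _)) (hm.mono (le_max_right _ _))⟩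

/-- Cover `B` by a projective with weakly trivial kernel `K`. The kernel of the composite cover of
`D` is an extension of `A` by `K`. -/
lemma WTriv.of_conf₃ {A B D : C} {i : A ⟶ B} {p : B ⟶ D} (h : E.Conf i p)
    (hA : E.WTriv A) (hB : E.WTriv B) : E.WTriv D := by
  obtain ⟨K, P, a, α, ha, hP, hK⟩ := hB.exists_conf
  obtain ⟨L, b, c, e, hb, hc, -⟩ := ha.exists_comp_deflation h
  obtain ⟨n, hn⟩ := hK.of_conf₂ hc hA
  exact ⟨n + 1, hb.projDimLE_succ hP hn⟩

/-- Pull the conflation back along a projective cover `P` of `D` with weakly trivial kernel `K`. The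
middle term is an extension of `B` by `K`, and `A` is its kernel onto the projective `P`. -/
lemma WTriv.of_conf₁ {A B D : C} {i : A ⟶ B} {p : B ⟶ D} (h : E.Conf i p)
    (hB : E.WTriv B) (hD : E.WTriv D) : E.WTriv A := by
  obtain ⟨K, P, a, α, ha, hP, hK⟩ := hD.exists_conf
  obtain ⟨Q, f, q, j, sq, hj, -⟩ := h.exists_pullback α
  obtain ⟨j', hj', -⟩ := ha.of_isPullback sq.flip
  obtain ⟨n, hn⟩ := hK.of_conf₂ hj' hB
  exact ⟨n, .of_conf_projective hj hP hn⟩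

lemma IsGorenstein.wTriv_of_injDimLE (hE : E.IsGorenstein) {n : ℕ} {X : C}
    (h : E.InjDimLE n X) : E.WTriv X := by
  induction h with
  | zero X hX => exact hE.wTriv_of_isInjective hX
  | succ n S hS hI _ ih =>
    exact .of_conf₁ (conf_of_conflation hS) (hE.wTriv_of_isInjective hI) ih

/-- Finite injective dimension implies finite projective dimension because injectives are weakly
trivial and two-out-of-three holds. The converse is the same argument in the opposite category. -/
lemma IsGorenstein.wTriv_op_iff (hE : E.IsGorenstein) {X : Cᵒᵖ} :
    E.op.WTriv X ↔ E.WTriv X.unop := by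
  constructor
  · rintro ⟨n, h⟩
    exact hE.wTriv_of_injDimLE (projDimLE_op_iff.1 h)
  · rintro ⟨n, h⟩
    exact hE.op.wTriv_of_injDimLE (injDimLE_op_iff.2 h)

end Dimension

/-! ### Yoneda Ext by resolutions; splitting criteria for Gorenstein objects -/

section YonedaExt

variable {C : Type u} [Category.{v} C] [Preadditive C] {E : ConflationClass C}

lemma Extension.conf {X Y : C} (e : E.Extension X Y) : E.Conf e.i e.p := ⟨e.w, e.conflation⟩

namespace YonedaExtension

/-- All middle terms of the exact sequence are projective. -/
def IsProjective : ∀ {n : ℕ} {X Y : C}, E.YonedaExtension n X Y → Prop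
  | _, _, _, .single e => E.IsProjective e.M
  | _, _, _, .splice e ξ => E.IsProjective e.M ∧ ξ.IsProjective

/-- The morphism `f` extends along the first inflation of the exact sequence. -/
def Extends : ∀ {n : ℕ} {X K : C}, E.YonedaExtension n X K → ∀ {Y : C}, (K ⟶ Y) → Prop
  | _, _, _, .single e, _, f => ∃ g, e.i ≫ g = f
  | _, _, _, .splice e _, _, f => ∃ g, e.i ≫ g = f

/-- A morphism that factors through a projective middle term lifts along every deflation, since the
second factor does. -/
lemma Extends.exists_lift {n : ℕ} {X K : C} {ρ : E.YonedaExtension n X K} (hρ : ρ.IsProjective)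
    {A B Y : C} {i : A ⟶ B} {p : B ⟶ Y} (h : E.Conf i p) {f : K ⟶ Y} (hf : ρ.Extends f) :
    ∃ g, g ≫ p = f := by
  cases ρ with
  | single e =>
    obtain ⟨k, rfl⟩ := hf
    obtain ⟨g, rfl⟩ := ConflationClass.IsProjective.exists_lift hρ h k
    exact ⟨e.i ≫ g, by simp⟩
  | splice e ρ =>
    obtain ⟨k, rfl⟩ := hf
    obtain ⟨g, rfl⟩ := ConflationClass.IsProjective.exists_lift hρ.1 h k
    exact ⟨e.i ≫ g, by simp⟩

lemma isEmpty_zero {X Y : C} (ξ : E.YonedaExtension 0 X Y) : False := by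
  cases ξ

lemma Morphism.id {n : ℕ} {X Y : C} (ξ : E.YonedaExtension n X Y) : ξ.Morphism (𝟙 Y) ξ := by
  induction ξ with
  | single e => exact .single _ _ _ (𝟙 _) (by simp) (by simp)
  | splice e ξ ih => exact .splice _ _ _ _ _ (𝟙 _) (𝟙 _) (by simp) (by simp) ih

lemma Morphism.comp {n : ℕ} {X Y Y' Y'' : C} {ξ : E.YonedaExtension n X Y}
    {ξ' : E.YonedaExtension n X Y'} {ξ'' : E.YonedaExtension n X Y''} {f : Y ⟶ Y'} {f' : Y' ⟶ Y''}
    (h : ξ.Morphism f ξ') (h' : ξ'.Morphism f' ξ'') : ξ.Morphism (f ≫ f') ξ'' := by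
  induction h generalizing Y'' with
  | single e e' f m hi hp =>
    cases h' with
    | single _ e'' f' m' hi' hp' =>
      exact .single _ _ _ (m ≫ m') (by simp [reassoc_of% hi, hi']) (by simp [hp, hp'])
  | splice e e' ξ ξ' f g m hi hp h ih =>
    cases h' with
    | splice _ e'' _ ξ'' f' g' m' hi' hp' h' =>
      exact .splice _ _ _ _ _ (g ≫ g') (m ≫ m') (by simp [reassoc_of% hi, hi'])
        (by simp [hp', reassoc_of% hp]) (ih h')

/-- Adding a null-homotopic morphism: if `g` extends by `k`, then `k ≫ e'.i` corrects the middle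
component and leaves everything to its right unchanged. -/
lemma Morphism.add {n : ℕ} {X K Y : C} {ρ : E.YonedaExtension n X K}
    {ξ : E.YonedaExtension n X Y} {f g : K ⟶ Y} (h : ρ.Morphism f ξ) (hg : ρ.Extends g) :
    ρ.Morphism (f + g) ξ := by
  cases h with
  | single e e' f m hi hp =>
    obtain ⟨k, rfl⟩ := hg
    exact .single _ _ _ (m + k ≫ e'.i) (by simp [hi]) (by simp [hp, e'.w])
  | splice e e' ξ ξ' f g m hi hp h =>
    obtain ⟨k, rfl⟩ := hg
    exact .splice _ _ _ _ _ g (m + k ≫ e'.i) (by simp [hi]) (by simp [hp, e'.w]) h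

variable [E.IsExactCategory]

/-- Two lifts of the identity of `X` to a morphism from a projective resolution of `X` to another
exact sequence are homotopic. -/
lemma Morphism.extends_sub {n : ℕ} {X K Y : C} {ρ : E.YonedaExtension n X K}
    (hρ : ρ.IsProjective) {ξ : E.YonedaExtension n X Y} {f f' : K ⟶ Y} (h : ρ.Morphism f ξ)
    (h' : ρ.Morphism f' ξ) : ρ.Extends (f - f') := by
  induction h with
  | single e e' f m hi hp =>
    cases h' with
    | single _ _ _ m' hi' hp' =>
      obtain ⟨k, hk⟩ := e'.conf.exists_lift (m - m') (by simp [hp, hp'])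
      have := e'.conf.mono
      exact ⟨k, by rw [← cancel_mono e'.i, Category.assoc, hk]; simp [hi, hi']⟩
  | splice e e' ξ ξ' f g m hi hp h ih =>
    cases h' with
    | splice _ _ _ _ _ g' m' hi' hp' h' =>
      obtain ⟨l, hl⟩ := (ih hρ.2 h').exists_lift hρ.2 e'.conf
      obtain ⟨k, hk⟩ := e'.conf.exists_lift (m - m' - e.p ≫ l) (by simp [hp, hp', hl])
      have := e'.conf.mono
      exact ⟨k, by
        rw [← cancel_mono e'.i, Category.assoc, hk]; simp [hi, hi', reassoc_of% e.w]⟩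

lemma IsProjective.exists_morphism {n : ℕ} {X K : C} {ρ : E.YonedaExtension n X K}
    (hρ : ρ.IsProjective) {Y : C} (ξ : E.YonedaExtension n X Y) : ∃ f, ρ.Morphism f ξ := by
  induction ρ generalizing Y with
  | single e =>
    cases ξ with
    | single e' =>
      obtain ⟨m, hm⟩ := ConflationClass.IsProjective.exists_lift hρ e'.conf e.p
      obtain ⟨f, hf⟩ := e'.conf.exists_lift (e.i ≫ m) (by simp [hm, e.w])
      exact ⟨f, .single _ _ _ m hf.symm hm⟩
    | splice _ ξ => exact (isEmpty_zero ξ).elim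
  | splice e ρ ih =>
    cases ξ with
    | single => exact (isEmpty_zero ρ).elim
    | splice e' ξ =>
      obtain ⟨g, hg⟩ := ih hρ.2 ξ
      obtain ⟨m, hm⟩ := ConflationClass.IsProjective.exists_lift hρ.1 e'.conf (e.p ≫ g)
      obtain ⟨f, hf⟩ := e'.conf.exists_lift (e.i ≫ m) (by simp [hm, reassoc_of% e.w])
      exact ⟨f, .splice _ _ _ _ _ g m hf.symm hm hg⟩

/-- The cobase change of an exact sequence along a morphism from its first term. -/
lemma exists_pushout {n : ℕ} {X K Y : C} (ρ : E.YonedaExtension n X K) (f : K ⟶ Y) :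
    ∃ ξ : E.YonedaExtension n X Y, ρ.Morphism f ξ ∧
      ∀ ξ' : E.YonedaExtension n X Y, ρ.Morphism f ξ' → ξ.Morphism (𝟙 Y) ξ' := by
  cases ρ with
  | single e =>
    obtain ⟨M, m, i, p, sq, hc, hm⟩ := e.conf.exists_pushout f
    refine ⟨.single ⟨M, i, p, hc.1, hc.2⟩, .single _ _ _ m sq.w hm, fun ξ' h => ?_⟩
    cases h with
    | single _ e' _ m' hi hp =>
      exact .single _ _ _ (sq.desc m' e'.i hi) (by simp)
        (sq.hom_ext (by simp [hp, hm]) (by simp [hc.1, e'.w]))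
  | splice e ρ =>
    obtain ⟨M, m, i, p, sq, hc, hm⟩ := e.conf.exists_pushout f
    refine ⟨.splice ⟨M, i, p, hc.1, hc.2⟩ ρ,
      .splice _ _ _ _ _ (𝟙 _) m sq.w (by simp [hm]) (.id ρ), fun ξ' h => ?_⟩
    cases h with
    | splice _ e' _ _ _ g m' hi hp h =>
      exact .splice _ _ _ _ _ g (sq.desc m' e'.i hi) (by simp)
        (sq.hom_ext (by simp [hp, reassoc_of% hm]) (by simp [reassoc_of% hc.1, e'.w])) h

end YonedaExtension

open YonedaExtension in
/-- The Yoneda Ext is computed by projective resolutions. -/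
lemma extVanishes_iff_extends [E.IsExactCategory] {n : ℕ} {X K Y : C} {ρ : E.YonedaExtension n X K}
    (hρ : ρ.IsProjective) : E.ExtVanishes n X Y ↔ ∀ f : K ⟶ Y, ρ.Extends f := by
  constructor
  · intro h f
    -- An extension class goes to the set of all left ends of lifts of the identity from the
    -- resolution. Such lifts are unique up to morphisms that extend, so the set is a full coset and
    -- depends only on the class. If Ext has one element, the cosets of `f` and of `0` coincide, so
    -- `f` extends.
    let φ : E.Ext n X Y → Set (K ⟶ Y) := Quot.lift (fun ξ => {g | ρ.Morphism g ξ}) (by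
      intro ξ ξ' hξ
      ext g
      constructor
      · intro hg
        simpa using Morphism.comp hg hξ
      · intro hg
        obtain ⟨g', hg'⟩ := hρ.exists_morphism ξ
        have := hg'.add (Morphism.extends_sub hρ hg (by simpa using hg'.comp hξ))
        simpa using this)
    obtain ⟨ξ, hξ, -⟩ := ρ.exists_pushout f
    obtain ⟨ξ', hξ', -⟩ := ρ.exists_pushout (0 : K ⟶ Y)
    have h' : f ∈ φ (Quot.mk _ ξ') := by
      rw [h.elim (Quot.mk _ ξ') (Quot.mk _ ξ)]
      exact hξ
    simpa using Morphism.extends_sub hρ h' hξ'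
  · refine fun h => ⟨fun a b => ?_⟩
    obtain ⟨ξ, rfl⟩ := Quot.exists_rep a
    obtain ⟨ξ', rfl⟩ := Quot.exists_rep b
    obtain ⟨f, hf⟩ := hρ.exists_morphism ξ
    obtain ⟨f', hf'⟩ := hρ.exists_morphism ξ'
    obtain ⟨ζ, -, hζ⟩ := ρ.exists_pushout f
    have hf'' : ρ.Morphism f ξ' := by simpa using hf'.add (h (f - f'))
    exact (Quot.sound (hζ ξ hf)).symm.trans (Quot.sound (hζ ξ' hf''))

/-- `E.Syzygy n X Z`: the object `Z` is an `n`-th syzygy of `X`. -/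
inductive Syzygy (E : ConflationClass C) (X : C) : ℕ → C → Prop
  | zero : Syzygy E X 0 X
  | succ {n : ℕ} {K P Z : C} (i : K ⟶ P) (p : P ⟶ Z) (h : E.Conf i p) (hP : E.IsProjective P)
      (hZ : Syzygy E X n Z) : Syzygy E X (n + 1) K

lemma Syzygy.exists_yonedaExtension {X Z : C} {n : ℕ} (hZ : E.Syzygy X n Z) {K P : C} {i : K ⟶ P}
    {p : P ⟶ Z} (h : E.Conf i p) (hP : E.IsProjective P) :
    ∃ ρ : E.YonedaExtension (n + 1) X K, ρ.IsProjective ∧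
      ∀ {Y : C} (f : K ⟶ Y), ρ.Extends f ↔ ∃ g, i ≫ g = f := by
  induction hZ generalizing K P with
  | zero => exact ⟨.single ⟨P, i, p, h.1, h.2⟩, hP, fun f => Iff.rfl⟩
  | succ j q hc hQ _ ih =>
    obtain ⟨ρ, hρ, -⟩ := ih hc hQ
    exact ⟨.splice ⟨P, i, p, h.1, h.2⟩ ρ, ⟨hP, hρ⟩, fun f => Iff.rfl⟩

lemma extVanishes_succ_iff_of_syzygy [E.IsExactCategory] {X Z : C} {n : ℕ} (hZ : E.Syzygy X n Z)
    {K P : C} {i : K ⟶ P} {p : P ⟶ Z} (h : E.Conf i p) (hP : E.IsProjective P) {Y : C} :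
    E.ExtVanishes (n + 1) X Y ↔ E.Splits Z Y := by
  obtain ⟨ρ, hρ, hext⟩ := hZ.exists_yonedaExtension h hP
  rw [extVanishes_iff_extends hρ]
  simp only [hext]
  exact ⟨splits_of_extension h hP, fun hs f => hs.exists_extension h f⟩

/-- `Ext^{n+1}(X, Y) = 0`, in the form that `Ext¹(Z, Y) = 0` for all `n`-th syzygies `Z`
of `X`. -/
def SyzygySplits (E : ConflationClass C) : ℕ → C → C → Prop
  | 0, X, Y => E.Splits X Y
  | n + 1, X, Y => ∀ ⦃K P : C⦄ (i : K ⟶ P) (p : P ⟶ X), E.Conf i p → E.IsProjective P →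
      E.SyzygySplits n K Y

lemma syzygySplits_add_iff {n m : ℕ} {X Y : C} :
    E.SyzygySplits (n + m) X Y ↔ ∀ Z, E.Syzygy X n Z → E.SyzygySplits m Z Y := by
  induction n generalizing m with
  | zero =>
    rw [Nat.zero_add]
    exact ⟨fun h Z hZ => by cases hZ; exact h, fun h => h X .zero⟩
  | succ n ih =>
    rw [Nat.add_right_comm, Nat.add_assoc, ih]
    constructor
    · intro h Z hZ
      cases hZ with
      | succ i p hc hP hZ => exact h _ hZ i p hc hP
    · intro h Z hZ K P i p hc hP
      exact h K (.succ i p hc hP hZ)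

/-- Ext vanishing does not mention a chosen syzygy. Hence splitting for one `n`-th syzygy, which
exists because there are enough projectives, is equivalent to splitting for all of them. -/
lemma extVanishes_succ_iff [E.IsExactCategory] (hE : E.IsGorenstein) {n : ℕ} {X Y : C} :
    E.ExtVanishes (n + 1) X Y ↔ E.SyzygySplits n X Y := by
  have key : ∀ Z, E.Syzygy X n Z → (E.ExtVanishes (n + 1) X Y ↔ E.Splits Z Y) := fun Z hZ => by
    obtain ⟨K, P, i, p, hc, hP⟩ := hE.enoughProjectives Z
    exact extVanishes_succ_iff_of_syzygy hZ hc hP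
  have hex : ∀ m, ∃ Z, E.Syzygy X m Z := fun m => by
    induction m with
    | zero => exact ⟨X, .zero⟩
    | succ m ih =>
      obtain ⟨Z, hZ⟩ := ih
      obtain ⟨K, P, i, p, hc, hP⟩ := hE.enoughProjectives Z
      exact ⟨K, .succ i p hc hP hZ⟩
  obtain ⟨Z, hZ⟩ := hex n
  rw [show E.SyzygySplits n X Y ↔ _ from syzygySplits_add_iff (m := 0)]
  exact ⟨fun h Z hZ => (key Z hZ).1 h, fun h => (key Z hZ).2 (h Z hZ)⟩

/-- Balancing: vanishing of Ext can be tested on syzygies of the first or on cosyzygies of the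
second argument. -/
lemma syzygySplits_op_iff [E.IsExactCategory] (hE : E.IsGorenstein) {n : ℕ} {X Y : C} :
    E.op.SyzygySplits n (.op Y) (.op X) ↔ E.SyzygySplits n X Y := by
  induction n using Nat.strong_induction_on generalizing X Y with
  | _ n ih =>
    match n with
    | 0 => exact splits_op_iff
    | 1 =>
      obtain ⟨K, P, i, p, h, hP⟩ := hE.enoughProjectives X
      obtain ⟨I, L, j, q, h', hI⟩ := hE.enoughInjectives Y
      constructor
      · intro hs K P i p h hP
        exact (splits_syzygy_iff h hP h' hI).2
          (splits_op_iff.1 (hs q.op j.op h'.op (isProjective_op_iff.2 hI)))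
      · intro hs L I q j h' hI
        exact splits_op_iff.2 ((splits_syzygy_iff h hP h'.unop (isProjective_op_iff.1 hI)).1
          (hs i p h hP))
    -- One syzygy of `X` and one cosyzygy of `Y` are exchanged, which costs two degrees; hence the
    -- strong induction and the two base cases.
    | n + 2 =>
      constructor
      · intro hs K P i p h hP
        refine (ih (n + 1) (by omega)).1 fun L I q j h' hI => ?_
        exact (ih n (by omega) (Y := L.unop)).2
          ((ih (n + 1) (by omega) (Y := L.unop)).1 (hs q j h' hI) i p h hP)
      · intro hs L I q j h' hI
        refine (ih (n + 1) (by omega) (Y := L.unop)).2 fun K P i p h hP => ?_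
        exact (ih n (by omega) (Y := L.unop)).1
          ((ih (n + 1) (by omega)).2 (hs i p h hP) q j h' hI)

lemma gProj_iff_syzygySplits [E.IsExactCategory] (hE : E.IsGorenstein) {X : C} :
    E.GProj X ↔ ∀ n P, E.IsProjective P → E.SyzygySplits n X P := by
  constructor
  · exact fun h n P hP => (extVanishes_succ_iff hE).1 (h _ n.succ_pos P hP)
  · intro h j hj P hP
    obtain ⟨n, rfl⟩ := Nat.exists_eq_succ_of_ne_zero hj.ne'
    exact (extVanishes_succ_iff hE).2 (h n P hP)

/-- In the opposite category the resolution is of the second argument of Ext, so balancing is needed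
here. -/
lemma gProj_op_iff [E.IsExactCategory] (hE : E.IsGorenstein) {X : Cᵒᵖ} :
    E.op.GProj X ↔ E.GInj X.unop := by
  rw [gProj_iff_syzygySplits hE.op]
  constructor
  · intro h j hj I hI
    obtain ⟨n, rfl⟩ := Nat.exists_eq_succ_of_ne_zero hj.ne'
    exact (extVanishes_succ_iff hE).2
      ((syzygySplits_op_iff hE).1 (h n (.op I) (isProjective_op_iff.2 hI)))
  · intro h n P hP
    exact (syzygySplits_op_iff hE).2
      ((extVanishes_succ_iff hE).1 (h _ n.succ_pos _ (isProjective_op_iff.1 hP)))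

/-- Gorenstein projective objects are those without extensions by weakly trivial objects. -/
lemma gProj_iff [E.IsExactCategory] (hE : E.IsGorenstein) {X : C} :
    E.GProj X ↔ ∀ W, E.WTriv W → E.Splits X W := by
  rw [gProj_iff_syzygySplits hE]
  constructor
  · rintro h W ⟨m, hm⟩
    induction m generalizing X W with
    | zero => exact h 0 W (projDimLE_zero_iff.1 hm)
    | succ m ih =>
      obtain ⟨K, Q, a, α, ha, hQ, hK⟩ := hm.exists_conf
      obtain ⟨L, P, i, p, hc, hP⟩ := hE.enoughProjectives X
      refine splits_of_extension hc hP fun f => ?_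
      -- The syzygy `L` of `X` satisfies the same hypothesis, so `f` lifts along `Q ⟶ W` by
      -- induction on the dimension of `W`. The lift extends to `P` because `Q` is projective.
      obtain ⟨g, hg⟩ := (ih (fun n R hR => h (n + 1) R hR i p hc hP) K hK).exists_lift ha f
      obtain ⟨g', hg'⟩ := (show E.Splits X Q from h 0 Q hQ).exists_extension hc g
      exact ⟨g' ≫ α, by rw [reassoc_of% hg', hg]⟩
  · intro h n R hR
    induction n generalizing X with
    | zero => exact h R hR.wTriv
    | succ n ih =>
      intro K P i p hc hP
      refine ih fun W hW => ?_
      -- The hypothesis passes to syzygies of `X`: shift the degree to a cosyzygy `L` of `W`, which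
      -- is again weakly trivial.
      obtain ⟨I, L, j, q, hc', hI⟩ := hE.enoughInjectives W
      exact (splits_syzygy_iff hc hP hc' hI).2
        (h L (hW.of_conf₃ hc' (hE.wTriv_of_isInjective hI)))

lemma gInj_iff [E.IsExactCategory] (hE : E.IsGorenstein) {X : C} :
    E.GInj X ↔ ∀ W, E.WTriv W → E.Splits W X := by
  rw [show E.GInj X ↔ _ from (gProj_op_iff hE (X := .op X)).symm, gProj_iff hE.op]
  exact ⟨fun h W hW => splits_op_iff.1 (h (.op W) (hE.wTriv_op_iff.2 hW)),
    fun h W hW => splits_op_iff.2 (h _ (hE.wTriv_op_iff.1 hW))⟩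

lemma gInj_op_iff [E.IsExactCategory] (hE : E.IsGorenstein) {X : Cᵒᵖ} :
    E.op.GInj X ↔ E.GProj X.unop := by
  rw [gInj_iff hE.op, gProj_iff hE]
  exact ⟨fun h W hW => splits_op_iff.1 (h (.op W) (hE.wTriv_op_iff.2 hW)),
    fun h W hW => splits_op_iff.2 (h _ (hE.wTriv_op_iff.1 hW))⟩

end YonedaExt

/-! ### Closure properties and existence of approximations -/

section Approximation

variable {C : Type u} [Category.{v} C] [Preadditive C] {E : ConflationClass C}

lemma InjDimLE.exists_conf {n : ℕ} {X : C} (h : E.InjDimLE (n + 1) X) :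
    ∃ (I L : C) (i : X ⟶ I) (p : I ⟶ L), E.Conf i p ∧ E.IsInjective I ∧ E.InjDimLE n L := by
  cases h with
  | succ _ S hS hP hK => exact ⟨_, _, _, _, conf_of_conflation hS, hP, hK⟩

lemma injDimLE_zero_iff {X : C} : E.InjDimLE 0 X ↔ E.IsInjective X :=
  ⟨fun h => by cases h with | zero _ hX => exact hX, InjDimLE.zero X⟩

variable (E) in
/-- `E.IsSyzygy n Z`: the object `Z` is an `n`-th syzygy of some object. -/
def IsSyzygy (n : ℕ) (Z : C) : Prop := ∃ X, E.Syzygy X n Z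

lemma isSyzygy_zero (Z : C) : E.IsSyzygy 0 Z := ⟨Z, .zero⟩

lemma IsSyzygy.succ {n : ℕ} {Z : C} (hZ : E.IsSyzygy n Z) {K P : C} {i : K ⟶ P} {p : P ⟶ Z}
    (h : E.Conf i p) (hP : E.IsProjective P) : E.IsSyzygy (n + 1) K := by
  obtain ⟨X, hX⟩ := hZ
  exact ⟨X, .succ i p h hP hX⟩

lemma IsSyzygy.exists_conf {n : ℕ} {K : C} (hK : E.IsSyzygy (n + 1) K) :
    ∃ (P Z : C) (i : K ⟶ P) (p : P ⟶ Z), E.Conf i p ∧ E.IsProjective P ∧ E.IsSyzygy n Z := by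
  obtain ⟨X, hX⟩ := hK
  cases hX with
  | succ i p h hP hZ => exact ⟨_, _, i, p, h, hP, X, hZ⟩

/-- An `(n + 1)`-th syzygy of `X` is an `n`-th syzygy of a first syzygy of `X`. -/
lemma IsSyzygy.of_succ {n : ℕ} {K : C} (hK : E.IsSyzygy (n + 1) K) : E.IsSyzygy n K := by
  induction n generalizing K with
  | zero => exact isSyzygy_zero K
  | succ n ih =>
    obtain ⟨P, Z, i, p, h, hP, hZ⟩ := hK.exists_conf
    exact (ih hZ).succ h hP

variable [E.IsExactCategory]

lemma IsProjective.gProj (hE : E.IsGorenstein) {P : C} (hP : E.IsProjective P) : E.GProj P :=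
  (gProj_iff hE).2 fun _ _ => hP.splits _

lemma IsInjective.gInj (hE : E.IsGorenstein) {I : C} (hI : E.IsInjective I) : E.GInj I :=
  (gInj_iff hE).2 fun _ _ => hI.splits _

lemma gProj_of_conf₂ (hE : E.IsGorenstein) {A B D : C} {i : A ⟶ B} {p : B ⟶ D}
    (h : E.Conf i p) (hA : E.GProj A) (hD : E.GProj D) : E.GProj B := by
  rw [gProj_iff hE] at *
  exact fun W hW => .of_conf_left h (hA W hW) (hD W hW)

/-- For a weakly trivial `W` with injective hull `I` and cosyzygy `L`, a morphism `A ⟶ L` extends to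
`B` as `Ext¹(D, L) = 0`, and the extension lifts to `I` as `Ext¹(B, W) = 0`. -/
lemma gProj_of_conf₁ (hE : E.IsGorenstein) {A B D : C} {i : A ⟶ B} {p : B ⟶ D}
    (h : E.Conf i p) (hB : E.GProj B) (hD : E.GProj D) : E.GProj A := by
  rw [gProj_iff hE] at *
  intro W hW
  obtain ⟨I, L, j, q, hc, hI⟩ := hE.enoughInjectives W
  refine splits_of_lift hc hI fun f => ?_
  obtain ⟨g, hg⟩ := (hD L (hW.of_conf₃ hc (hE.wTriv_of_isInjective hI))).exists_extension h f
  obtain ⟨g', hg'⟩ := (hB W hW).exists_lift hc g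
  exact ⟨i ≫ g', by rw [Category.assoc, hg', hg]⟩

lemma gInj_of_conf₂ (hE : E.IsGorenstein) {A B D : C} {i : A ⟶ B} {p : B ⟶ D}
    (h : E.Conf i p) (hA : E.GInj A) (hD : E.GInj D) : E.GInj B :=
  (gProj_op_iff hE).1 (gProj_of_conf₂ hE.op h.op ((gProj_op_iff hE).2 hD)
    ((gProj_op_iff hE).2 hA))

lemma gInj_of_conf₃ (hE : E.IsGorenstein) {A B D : C} {i : A ⟶ B} {p : B ⟶ D}
    (h : E.Conf i p) (hA : E.GInj A) (hB : E.GInj B) : E.GInj D :=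
  (gProj_op_iff hE).1 (gProj_of_conf₁ hE.op h.op ((gProj_op_iff hE).2 hB)
    ((gProj_op_iff hE).2 hA))

/-- A weakly trivial object has a projective cover with weakly trivial kernel, and this cover splits
if the object is Gorenstein projective. -/
lemma isProjective_of_gProj_of_wTriv (hE : E.IsGorenstein) {X : C} (h : E.GProj X)
    (h' : E.WTriv X) : E.IsProjective X := by
  obtain ⟨K, P, i, p, hc, hP, hK⟩ := h'.exists_conf
  obtain ⟨s, hs⟩ := ((gProj_iff hE).1 h K hK).exists_section hc
  exact hP.of_retract hs

lemma isInjective_of_gInj_of_wTriv (hE : E.IsGorenstein) {X : C} (h : E.GInj X)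
    (h' : E.WTriv X) : E.IsInjective X :=
  isProjective_op_iff.1 (isProjective_of_gProj_of_wTriv hE.op ((gProj_op_iff (X := .op X) hE).2 h)
    (hE.wTriv_op_iff.2 h'))

/-- Dimension shifting `n` times replaces `Y` by an `n`-th cosyzygy, which is injective. -/
lemma IsSyzygy.splits {n : ℕ} {Z Y : C} (hZ : E.IsSyzygy n Z) (hY : E.InjDimLE n Y) :
    E.Splits Z Y := by
  induction n generalizing Z Y with
  | zero => exact (injDimLE_zero_iff.1 hY).splits Z
  | succ n ih =>
    obtain ⟨P, Z', i, p, h, hP, hZ'⟩ := hZ.exists_conf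
    obtain ⟨I, L, j, q, h', hI, hL⟩ := hY.exists_conf
    exact (splits_syzygy_iff h hP h' hI).2 (ih hZ' hL)

/-- Projectives have injective dimension at most `n`, so extensions of an `n`-th syzygy by them
split; further syzygies are still `n`-th syzygies. -/
lemma IsSyzygy.gProj {n : ℕ} (hE : E.IsNGorenstein n) {Z : C} (hZ : E.IsSyzygy n Z) :
    E.GProj Z := by
  refine (gProj_iff_syzygySplits ⟨n, hE⟩).2 fun m P hP => ?_
  induction m generalizing Z with
  | zero => exact hZ.splits (hE.injDim_of_projective P hP)
  | succ m ih => exact fun K Q i p h hQ => ih (hZ.succ h hQ).of_succ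

/-- A `k`-th syzygy embeds into an object of projective dimension at most `n - k` with a `k`-th
syzygy as cokernel. -/
lemma IsSyzygy.exists_embedding {n : ℕ} (hE : E.IsNGorenstein n) {k : ℕ} {Z : C}
    (hZ : E.IsSyzygy k Z) : ∃ (M Z' : C) (j : Z ⟶ M) (q : M ⟶ Z'),
      E.Conf j q ∧ E.ProjDimLE (n - k) M ∧ E.IsSyzygy k Z' := by
  have hG : E.IsGorenstein := ⟨n, hE⟩
  induction k generalizing Z with
  | zero =>
    obtain ⟨I, L, j, q, h, hI⟩ := hG.enoughInjectives Z
    exact ⟨I, L, j, q, h, hE.projDim_of_injective I hI, isSyzygy_zero L⟩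
  | succ k ih =>
    obtain ⟨P, Y, i, p, h, hP, hY⟩ := hZ.exists_conf
    obtain ⟨M, Y', j, q, hc, hM, hY'⟩ := ih hY
    obtain ⟨K', P', i', p', h', hP'⟩ := hG.enoughProjectives Y'
    obtain ⟨N, Q, b, β, c, e, hb, hQ, hce⟩ := hc.horseshoe h hP h' hP'
    -- The horseshoe makes `N` a syzygy of `M`. With truncated subtraction, `n - k ≤ n - (k + 1) +
    -- 1` also holds for `k ≥ n`.
    exact ⟨N, K', c, e, hce, hb.projDimLE hQ (hM.mono (by omega)), hY'.succ h' hP'⟩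

variable (E) in
/-- Extensions of `n`-th syzygies by projective objects. -/
def IsStableSyzygy (n : ℕ) (G : C) : Prop :=
  ∃ (P S : C) (i : P ⟶ G) (p : G ⟶ S), E.Conf i p ∧ E.IsProjective P ∧ E.IsSyzygy n S

/-- The extension of `S` by `P` splits since `S` is Gorenstein projective. An embedding of `S` into
a projective `Q` is pushed out along the section `S ⟶ G`, and the pushout is an extension of `P` by
`Q`. -/
lemma IsStableSyzygy.exists_embedding {n : ℕ} (hE : E.IsNGorenstein n) {G : C}
    (hG : E.IsStableSyzygy n G) : ∃ (Q S : C) (i : G ⟶ Q) (p : Q ⟶ S),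
      E.Conf i p ∧ E.IsProjective Q ∧ E.IsSyzygy n S := by
  obtain ⟨P, S, i, p, h, hP, hS⟩ := hG
  obtain ⟨Q, S', j, q, hc, hQ, hS'⟩ := hS.exists_embedding hE
  rw [Nat.sub_self, projDimLE_zero_iff] at hQ
  obtain ⟨s, hs⟩ := ((gProj_iff ⟨n, hE⟩).1 (hS.gProj hE) P hP.wTriv).exists_section h
  obtain ⟨r, -, hr⟩ := h.swap_of_section hs
  obtain ⟨R, f, g, d, sq, hg, -⟩ := hc.exists_pushout s
  obtain ⟨e, he, -⟩ := hr.of_isPushout sq.flip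
  exact ⟨R, S', g, d, hg, .of_conf he hQ hP, hS'⟩

/-- Induction on `d = n - k`. Let `K` be a syzygy of `Z` with projective cover `P`, and let `G`
cover `K` with kernel `W`. Embed `G` into a projective `Q` with cokernel `S`. Then `B = Q/W` is
weakly trivial and contains `K` with cokernel `S`. The pushout of `P` and `B` over `K` maps onto `Z`
with kernel `B` and is an extension of `S` by `P`. -/
lemma IsSyzygy.exists_cover {n : ℕ} (hE : E.IsNGorenstein n) {k d : ℕ} (hk : k + d = n) {Z : C}
    (hZ : E.IsSyzygy k Z) : ∃ (W G : C) (j : W ⟶ G) (q : G ⟶ Z),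
      E.Conf j q ∧ E.WTriv W ∧ E.IsStableSyzygy n G := by
  induction d generalizing k Z with
  | zero =>
    obtain rfl : k = n := hk
    obtain ⟨O, i, hO, hi⟩ := E.exists_conf_zero_id Z
    exact ⟨O, Z, i, 𝟙 Z, hi, wTriv_of_isZero hO, O, Z, i, 𝟙 Z, hi, isProjective_of_isZero hO, hZ⟩
  | succ d ih =>
    obtain ⟨K, P, i, p, h, hP⟩ := IsGorenstein.enoughProjectives ⟨n, hE⟩ Z
    obtain ⟨W, G, j, q, hc, hW, hG⟩ := ih (by omega) (hZ.succ h hP)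
    obtain ⟨Q, S, a, b, hab, hQ, hS⟩ := hG.exists_embedding hE
    obtain ⟨B, r, c, e, hr, hce, -⟩ := hc.exists_comp_inflation hab
    have hB : E.WTriv B := hW.of_conf₃ hr hQ.wTriv
    obtain ⟨G', f, g, t, sq, hg, -⟩ := h.exists_pushout c
    obtain ⟨t', ht', -⟩ := hce.of_isPushout sq.flip
    exact ⟨B, G', g, t, hg, hB, P, S, f, t', ht', hP, hS⟩

/-- Every object has a Gorenstein projective cover with weakly trivial kernel. -/
lemma IsGorenstein.exists_gProj_cover (hE : E.IsGorenstein) (X : C) :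
    ∃ (W G : C) (j : W ⟶ G) (q : G ⟶ X), E.Conf j q ∧ E.WTriv W ∧ E.GProj G := by
  obtain ⟨n, hn⟩ := hE
  obtain ⟨W, G, j, q, h, hW, P, S, i, p, hc, hP, hS⟩ :=
    (isSyzygy_zero (E := E) X).exists_cover hn (Nat.zero_add n)
  exact ⟨W, G, j, q, h, hW, gProj_of_conf₂ ⟨n, hn⟩ hc (hP.gProj ⟨n, hn⟩) (hS.gProj hn)⟩

/-- Every object has a Gorenstein injective hull with weakly trivial cokernel. -/
lemma IsGorenstein.exists_gInj_hull (hE : E.IsGorenstein) (X : C) :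
    ∃ (F W : C) (j : X ⟶ F) (q : F ⟶ W), E.Conf j q ∧ E.WTriv W ∧ E.GInj F := by
  obtain ⟨W, G, j, q, h, hW, hG⟩ := hE.op.exists_gProj_cover (.op X)
  exact ⟨G.unop, W.unop, q.unop, j.unop, h.unop, hE.wTriv_op_iff.1 hW, (gProj_op_iff hE).1 hG⟩

/-- Gorenstein projective objects embed into projective objects with Gorenstein projective
cokernel. -/
lemma IsGorenstein.exists_projective_hull (hE : E.IsGorenstein) {G : C} (hG : E.GProj G) :
    ∃ (Q G' : C) (i : G ⟶ Q) (p : Q ⟶ G'), E.Conf i p ∧ E.IsProjective Q ∧ E.GProj G' := by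
  obtain ⟨I, L, j, q, h, hI⟩ := hE.enoughInjectives G
  -- The pullback of `I` and `G'` over `L` is an extension of `G'` by `G`, hence Gorenstein
  -- projective, and of `I` by `W`, hence weakly trivial; so it is projective.
  obtain ⟨W, G', a, b, hc, hW, hG'⟩ := hE.exists_gProj_cover L
  obtain ⟨B, f, g, i, sq, hi, -⟩ := h.exists_pullback b
  obtain ⟨i', hi', -⟩ := hc.of_isPullback sq.flip
  exact ⟨B, G', i, g, hi, isProjective_of_gProj_of_wTriv hE (gProj_of_conf₂ hE hi hG hG')
    (hW.of_conf₂ hi' (hE.wTriv_of_isInjective hI)), hG'⟩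

/-- Gorenstein injective objects are quotients of injective objects with Gorenstein injective
kernel. -/
lemma IsGorenstein.exists_injective_cover (hE : E.IsGorenstein) {Y : C} (hY : E.GInj Y) :
    ∃ (Y' I : C) (i : Y' ⟶ I) (p : I ⟶ Y), E.Conf i p ∧ E.IsInjective I ∧ E.GInj Y' := by
  obtain ⟨Q, G', i, p, h, hQ, hG⟩ :=
    hE.op.exists_projective_hull ((gProj_op_iff (X := .op Y) hE).2 hY)
  exact ⟨G'.unop, Q.unop, p.unop, i.unop, h.unop, isProjective_op_iff.1 hQ,
    (gProj_op_iff hE).1 hG⟩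

end Approximation

/-! ### The induced exact structures are Frobenius -/

section Restrict

variable {C : Type u} [Category.{v} C] [Preadditive C] {E : ConflationClass C}

lemma conf_restrict_iff {P : ObjectProperty C} {A B D : P.FullSubcategory} {i : A ⟶ B}
    {p : B ⟶ D} : (E.restrict P).Conf i p ↔ E.Conf i.hom p.hom :=
  ⟨fun ⟨w, h⟩ => ⟨congrArg (fun f => f.hom) w, h⟩,
    fun ⟨w, h⟩ => ⟨ObjectProperty.hom_ext _ w, h⟩⟩

/-- A criterion for an exact subcategory to be Frobenius, with `Q` the class of projective-injective
objects. -/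
lemma isFrobenius_restrict {P : ObjectProperty C} (hP : (E.restrict P).IsExactCategory)
    (Q : C → Prop) (hQ : ∀ ⦃X Y : C⦄ (s : X ⟶ Y) (r : Y ⟶ X), s ≫ r = 𝟙 X → Q Y → Q X)
    (lift : ∀ ⦃X A B D : C⦄ (i : A ⟶ B) (p : B ⟶ D), Q X → P A → P B → P D → E.Conf i p →
      ∀ f : X ⟶ D, ∃ g, g ≫ p = f)
    (extend : ∀ ⦃X A B D : C⦄ (i : A ⟶ B) (p : B ⟶ D), Q X → P A → P B → P D → E.Conf i p →
      ∀ f : A ⟶ X, ∃ g, i ≫ g = f)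
    (cover : ∀ X, P X → ∃ (K R : C) (i : K ⟶ R) (p : R ⟶ X), E.Conf i p ∧ P K ∧ P R ∧ Q R)
    (hull : ∀ X, P X → ∃ (R K : C) (i : X ⟶ R) (p : R ⟶ K), E.Conf i p ∧ P K ∧ P R ∧ Q R) :
    (E.restrict P).IsFrobenius ∧ (∀ X, (E.restrict P).IsProjective X ↔ Q X.obj) ∧
      ∀ X, (E.restrict P).IsInjective X ↔ Q X.obj := by
  have hproj : ∀ X : P.FullSubcategory, Q X.obj → (E.restrict P).IsProjective X := fun X hX => by
    refine isProjective_iff.2 fun A B D i p h f => ?_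
    obtain ⟨g, hg⟩ := lift _ _ hX A.2 B.2 D.2 (conf_restrict_iff.1 h) f.hom
    exact ⟨ObjectProperty.homMk g, ObjectProperty.hom_ext _ hg⟩
  have hinj : ∀ X : P.FullSubcategory, Q X.obj → (E.restrict P).IsInjective X := fun X hX => by
    refine isInjective_iff.2 fun A B D i p h f => ?_
    obtain ⟨g, hg⟩ := extend _ _ hX A.2 B.2 D.2 (conf_restrict_iff.1 h) f.hom
    exact ⟨ObjectProperty.homMk g, ObjectProperty.hom_ext _ hg⟩
  have hcover : ∀ X : P.FullSubcategory, ∃ (K R : P.FullSubcategory) (i : K ⟶ R) (p : R ⟶ X),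
      (E.restrict P).Conf i p ∧ Q R.obj := fun X => by
    obtain ⟨K, R, i, p, h, hK, hR, hR'⟩ := cover X.obj X.2
    exact ⟨⟨K, hK⟩, ⟨R, hR⟩, ObjectProperty.homMk i, ObjectProperty.homMk p,
      conf_restrict_iff.2 h, hR'⟩
  have hhull : ∀ X : P.FullSubcategory, ∃ (R K : P.FullSubcategory) (i : X ⟶ R) (p : R ⟶ K),
      (E.restrict P).Conf i p ∧ Q R.obj := fun X => by
    obtain ⟨R, K, i, p, h, hK, hR, hR'⟩ := hull X.obj X.2
    exact ⟨⟨R, hR⟩, ⟨K, hK⟩, ObjectProperty.homMk i, ObjectProperty.homMk p,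
      conf_restrict_iff.2 h, hR'⟩
  have hproj' : ∀ X, (E.restrict P).IsProjective X ↔ Q X.obj := fun X => by
    refine ⟨fun hX => ?_, hproj X⟩
    obtain ⟨K, R, i, p, h, hR⟩ := hcover X
    obtain ⟨s, hs⟩ := hX.exists_lift h (𝟙 X)
    exact hQ _ _ (congrArg (fun f => f.hom) hs) hR
  have hinj' : ∀ X, (E.restrict P).IsInjective X ↔ Q X.obj := fun X => by
    refine ⟨fun hX => ?_, hinj X⟩
    obtain ⟨R, K, i, p, h, hR⟩ := hhull X
    obtain ⟨s, hs⟩ := hX.exists_desc h (𝟙 X)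
    exact hQ _ _ (congrArg (fun f => f.hom) hs) hR
  refine ⟨⟨fun X => ?_, fun X => ?_, fun X => (hproj' X).trans (hinj' X).symm⟩, hproj', hinj'⟩
  · obtain ⟨K, R, i, p, h, hR⟩ := hcover X
    exact ⟨R, p, hproj R hR, h.deflation⟩
  · obtain ⟨R, K, i, p, h, hR⟩ := hhull X
    exact ⟨R, i, hinj R hR, h.inflation⟩

variable [E.IsExactCategory]

lemma hasFiniteBiproducts_fullSubcategory {P : ObjectProperty C}
    (hP : ∀ ⦃A B D : C⦄ (i : A ⟶ B) (p : B ⟶ D), E.Conf i p → P A → P D → P B)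
    (hZ : ∀ Z, IsZero Z → P Z) : HasFiniteBiproducts P.FullSubcategory := by
  have := IsExactCategory.hasFiniteBiproducts (E := E)
  have : HasBinaryBiproducts C := hasBinaryBiproducts_of_finite_biproducts C
  have : HasZeroObject C := hasZeroObject_of_hasFiniteBiproducts C
  obtain ⟨Z, hZ₀⟩ := HasZeroObject.zero (C := C)
  have : HasZeroObject P.FullSubcategory :=
    ⟨⟨Z, hZ Z hZ₀⟩, by
      rw [IsZero.iff_id_eq_zero]
      exact ObjectProperty.hom_ext _ (hZ₀.eq_of_src _ _)⟩
  have : HasBinaryBiproducts P.FullSubcategory := ⟨fun X Y => hasBinaryBiproduct_of_total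
    { pt := ⟨X.obj ⊞ Y.obj, hP _ _ (conf_biprod _ _) X.property Y.property⟩
      fst := ObjectProperty.homMk biprod.fst
      snd := ObjectProperty.homMk biprod.snd
      inl := ObjectProperty.homMk biprod.inl
      inr := ObjectProperty.homMk biprod.inr
      inl_fst := ObjectProperty.hom_ext _ biprod.inl_fst
      inl_snd := ObjectProperty.hom_ext _ biprod.inl_snd
      inr_fst := ObjectProperty.hom_ext _ biprod.inr_fst
      inr_snd := ObjectProperty.hom_ext _ biprod.inr_snd }
    (ObjectProperty.hom_ext _ biprod.total)⟩
  have : HasFiniteProducts P.FullSubcategory := hasFiniteProducts_of_has_binary_and_terminal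
  exact HasFiniteBiproducts.of_hasFiniteProducts

/-- Extension closed full subcategories are exact categories. -/
lemma isExactCategory_restrict {P : ObjectProperty C}
    (hP : ∀ ⦃A B D : C⦄ (i : A ⟶ B) (p : B ⟶ D), E.Conf i p → P A → P D → P B)
    (hZ : ∀ Z, IsZero Z → P Z) : (E.restrict P).IsExactCategory where
  hasFiniteBiproducts := hasFiniteBiproducts_fullSubcategory hP hZ
  kernel S hS := by
    have h : E.Conf S.f.hom S.g.hom := conf_restrict_iff.1 (conf_of_conflation hS)
    have := h.mono
    refine ⟨Fork.IsLimit.mk' _ fun s => ?_⟩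
    have hd := h.exists_lift s.ι.hom (congrArg (fun f => f.hom) (KernelFork.condition s))
    exact ⟨ObjectProperty.homMk hd.choose, ObjectProperty.hom_ext _ hd.choose_spec, fun {m} hm =>
      ObjectProperty.hom_ext _ (by
        rw [← cancel_mono S.f.hom]
        exact (congrArg (fun f => f.hom) hm).trans hd.choose_spec.symm)⟩
  cokernel S hS := by
    have h : E.Conf S.f.hom S.g.hom := conf_restrict_iff.1 (conf_of_conflation hS)
    have := h.epi
    refine ⟨Cofork.IsColimit.mk' _ fun s => ?_⟩
    have hd := h.exists_desc s.π.hom (congrArg (fun f => f.hom) (CokernelCofork.condition s))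
    exact ⟨ObjectProperty.homMk hd.choose, ObjectProperty.hom_ext _ hd.choose_spec, fun {m} hm =>
      ObjectProperty.hom_ext _ (by
        rw [← cancel_epi S.g.hom]
        exact (congrArg (fun f => f.hom) hm).trans hd.choose_spec.symm)⟩
  of_iso S T := fun ⟨e⟩ hS =>
    IsExactCategory.of_iso (E := E) _ _ ⟨P.ι.mapShortComplex.mapIso e⟩ hS
  inflation_id X := by
    obtain ⟨Z, i, hZ₀, h⟩ := E.exists_conf_zero_id X.obj
    exact Conf.inflation (p := (0 : X ⟶ ⟨Z, hZ Z hZ₀⟩))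
      (conf_restrict_iff.2 (conf_id_zero hZ₀ (Iso.refl X.obj)))
  deflation_id X := by
    obtain ⟨Z, i, hZ₀, h⟩ := E.exists_conf_zero_id X.obj
    exact Conf.deflation (i := (0 : ⟨Z, hZ Z hZ₀⟩ ⟶ X))
      (conf_restrict_iff.2 (conf_zero_id hZ₀ (Iso.refl X.obj)))
  inflation_comp {X Y Z} i j := by
    rintro ⟨D₁, p, hi⟩ ⟨D₂, q, hj⟩
    obtain ⟨K, r, c, d, hr, hc, -⟩ :=
      (conf_restrict_iff.1 hi).exists_comp_inflation (conf_restrict_iff.1 hj)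
    let K₁ : P.FullSubcategory := ⟨K, hP _ _ hc D₁.2 D₂.2⟩
    exact Conf.inflation (p := (ObjectProperty.homMk r : Z ⟶ K₁)) (conf_restrict_iff.2 hr)
  deflation_comp {X Y Z} p q := by
    rintro ⟨D₁, i, hi⟩ ⟨D₂, j, hj⟩
    obtain ⟨K, r, c, d, hr, hc, -⟩ :=
      (conf_restrict_iff.1 hi).exists_comp_deflation (conf_restrict_iff.1 hj)
    let K₁ : P.FullSubcategory := ⟨K, hP _ _ hc D₁.2 D₂.2⟩
    exact Conf.deflation (i := (ObjectProperty.homMk r : K₁ ⟶ X)) (conf_restrict_iff.2 hr)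
  pushout {A B A'} i f := by
    rintro ⟨D, p, hi⟩
    obtain ⟨B', f', i', p', sq, hc, -⟩ := (conf_restrict_iff.1 hi).exists_pushout f.hom
    let B₁ : P.FullSubcategory := ⟨B', hP _ _ hc A'.2 D.2⟩
    exact ⟨B₁, ObjectProperty.homMk f', ObjectProperty.homMk i',
      IsPushout.of_map P.ι (ObjectProperty.hom_ext _ sq.w) sq,
      Conf.inflation (p := (ObjectProperty.homMk p' : B₁ ⟶ D)) (conf_restrict_iff.2 hc)⟩
  pullback {B D D'} p f := by
    rintro ⟨A, i, hi⟩
    obtain ⟨B', f', p', i', sq, hc, -⟩ := (conf_restrict_iff.1 hi).exists_pullback f.hom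
    let B₁ : P.FullSubcategory := ⟨B', hP _ _ hc A.2 D'.2⟩
    exact ⟨B₁, ObjectProperty.homMk f', ObjectProperty.homMk p',
      IsPullback.of_map P.ι (ObjectProperty.hom_ext _ sq.w) sq,
      Conf.deflation (i := (ObjectProperty.homMk i' : A ⟶ B₁)) (conf_restrict_iff.2 hc)⟩

/-- The projective-injectives are the ambient projectives. They are injective relative to Gorenstein
projectives because the cokernel of a conflation has no extensions by them. -/
lemma IsGorenstein.gProj_isFrobenius (hE : E.IsGorenstein) :
    E.gProj.IsFrobenius ∧ (∀ X, E.gProj.IsProjective X ↔ E.IsProjective X.obj) ∧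
      ∀ X, E.gProj.IsInjective X ↔ E.IsProjective X.obj :=
  isFrobenius_restrict
    (isExactCategory_restrict (fun _ _ _ _ _ => gProj_of_conf₂ hE)
      fun _ hZ => (isProjective_of_isZero hZ).gProj hE)
    E.IsProjective (fun _ _ _ _ h hQ => hQ.of_retract h)
    (fun _ _ _ _ _ _ hX _ _ _ h => hX.exists_lift h)
    (fun _ _ _ _ _ _ hX _ _ hD h => ((gProj_iff hE).1 hD _ hX.wTriv).exists_extension h)
    (fun X hX => by
      obtain ⟨K, P, i, p, h, hP⟩ := hE.enoughProjectives X
      exact ⟨K, P, i, p, h, gProj_of_conf₁ hE h (hP.gProj hE) hX, hP.gProj hE, hP⟩)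
    (fun X hX => by
      obtain ⟨P, K, i, p, h, hP, hK⟩ := hE.exists_projective_hull hX
      exact ⟨P, K, i, p, h, hK, hP.gProj hE, hP⟩)

lemma IsGorenstein.gInj_isFrobenius (hE : E.IsGorenstein) :
    E.gInj.IsFrobenius ∧ (∀ X, E.gInj.IsProjective X ↔ E.IsInjective X.obj) ∧
      ∀ X, E.gInj.IsInjective X ↔ E.IsInjective X.obj :=
  isFrobenius_restrict
    (isExactCategory_restrict (fun _ _ _ _ _ => gInj_of_conf₂ hE)
      fun _ hZ => ((isProjective_op_iff (X := .op _)).1 (isProjective_of_isZero hZ.op)).gInj hE)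
    E.IsInjective (fun _ _ _ _ h hQ => hQ.of_retract h)
    (fun _ _ _ _ _ _ hX hA _ _ h =>
      ((gInj_iff hE).1 hA _ (hE.wTriv_of_isInjective hX)).exists_lift h)
    (fun _ _ _ _ _ _ hX _ _ _ h => hX.exists_desc h)
    (fun X hX => by
      obtain ⟨K, P, i, p, h, hP, hK⟩ := hE.exists_injective_cover hX
      exact ⟨K, P, i, p, h, hK, hP.gInj hE, hP⟩)
    (fun X hX => by
      obtain ⟨P, K, i, p, h, hP⟩ := hE.enoughInjectives X
      exact ⟨P, K, i, p, h, gInj_of_conf₃ hE h hX (hP.gInj hE), hP.gInj hE, hP⟩)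

end Restrict

/-! ### Morphisms modulo those factoring through weakly trivial objects -/

section WeaklyTrivialIdeal

variable {C : Type u} [Category.{v} C] [Preadditive C] {E : ConflationClass C}

variable (E) in
/-- The morphisms which factor through weakly trivial objects. -/
def FactorsWTriv {X Y : C} (f : X ⟶ Y) : Prop :=
  ∃ (U : C) (a : X ⟶ U) (b : U ⟶ Y), E.WTriv U ∧ a ≫ b = f

lemma FactorsWTriv.comp_left {X Y Z : C} (f : X ⟶ Y) {g : Y ⟶ Z} (h : E.FactorsWTriv g) :
    E.FactorsWTriv (f ≫ g) := by
  obtain ⟨U, a, b, hU, rfl⟩ := h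
  exact ⟨U, f ≫ a, b, hU, by simp⟩

lemma FactorsWTriv.comp_right {X Y Z : C} {f : X ⟶ Y} (h : E.FactorsWTriv f) (g : Y ⟶ Z) :
    E.FactorsWTriv (f ≫ g) := by
  obtain ⟨U, a, b, hU, rfl⟩ := h
  exact ⟨U, a, b ≫ g, hU, by simp⟩

lemma FactorsWTriv.neg {X Y : C} {f : X ⟶ Y} (h : E.FactorsWTriv f) :
    E.FactorsWTriv (-f) := by
  obtain ⟨U, a, b, hU, rfl⟩ := h
  exact ⟨U, -a, b, hU, by simp⟩

lemma FactorsWTriv.of_wTriv_left {X Y : C} (hX : E.WTriv X) (f : X ⟶ Y) : E.FactorsWTriv f :=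
  ⟨X, 𝟙 X, f, hX, by simp⟩

lemma factorsWTriv_op_iff (hE : E.IsGorenstein) [E.IsExactCategory] {X Y : Cᵒᵖ} {f : X ⟶ Y} :
    E.op.FactorsWTriv f ↔ E.FactorsWTriv f.unop :=
  ⟨fun ⟨U, a, b, hU, h⟩ => ⟨U.unop, b.unop, a.unop, hE.wTriv_op_iff.1 hU, congrArg Quiver.Hom.unop h⟩,
    fun ⟨U, a, b, hU, h⟩ => ⟨.op U, b.op, a.op, hE.wTriv_op_iff.2 hU, congrArg Quiver.Hom.op h⟩⟩

variable [E.IsExactCategory]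

lemma FactorsWTriv.add {X Y : C} {f g : X ⟶ Y} (hf : E.FactorsWTriv f) (hg : E.FactorsWTriv g) :
    E.FactorsWTriv (f + g) := by
  obtain ⟨U, a, b, hU, rfl⟩ := hf
  obtain ⟨V, c, d, hV, rfl⟩ := hg
  have := IsExactCategory.hasFiniteBiproducts (E := E)
  have : HasBinaryBiproducts C := hasBinaryBiproducts_of_finite_biproducts C
  exact ⟨U ⊞ V, biprod.lift a c, biprod.desc b d, hU.of_conf₂ (conf_biprod U V) hV, by simp⟩

lemma factorsWTriv_zero (X Y : C) : E.FactorsWTriv (0 : X ⟶ Y) := by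
  obtain ⟨Z, i, hZ, -⟩ := E.exists_conf_zero_id X
  exact ⟨Z, 0, 0, wTriv_of_isZero hZ, by simp⟩

variable (E) in
/-- Congruence modulo morphisms which factor through weakly trivial objects. -/
def wTrivRel : HomRel C := fun _ _ f g => E.FactorsWTriv (f - g)

instance : Congruence E.wTrivRel where
  comp_left f g g' h := by
    have := FactorsWTriv.comp_left f h
    rwa [Preadditive.comp_sub] at this
  comp_right g h := by
    have := FactorsWTriv.comp_right h g
    rwa [Preadditive.sub_comp] at this
  equivalence :=
    { refl := fun f => by
        show E.FactorsWTriv (f - f)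
        rw [sub_self]
        exact factorsWTriv_zero _ _
      symm := fun {f g} h => by
        have := FactorsWTriv.neg h
        rwa [neg_sub] at this
      trans := fun {f g k} h h' => by
        have := FactorsWTriv.add h h'
        rwa [sub_add_sub_cancel] at this }

variable (E) in
/-- The projection to the quotient by the ideal of morphisms which factor through weakly trivial
objects. -/
abbrev modWTriv : C ⥤ CategoryTheory.Quotient E.wTrivRel := Quotient.functor E.wTrivRel

lemma modWTriv_map_eq_iff {X Y : C} {f g : X ⟶ Y} :
    E.modWTriv.map f = E.modWTriv.map g ↔ E.FactorsWTriv (f - g) :=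
  Quotient.functor_map_eq_iff _ f g

/-- The object `U` can be enlarged to a Gorenstein injective, weakly trivial `F`, because `Z` is
Gorenstein injective. Then `X ⟶ F` extends to `M`, and what remains of `k` kills `i`, so it factors
through `W`. -/
lemma Conf.factorsWTriv_of_inflation (hE : E.IsGorenstein) {X M W Z : C} {i : X ⟶ M} {q : M ⟶ W}
    (h : E.Conf i q) (hW : E.WTriv W) (hZ : E.GInj Z) {k : M ⟶ Z}
    (hk : E.FactorsWTriv (i ≫ k)) : E.FactorsWTriv k := by
  obtain ⟨U, a, b, hU, hab⟩ := hk
  obtain ⟨F, W', j, r, hc, hW', hF⟩ := hE.exists_gInj_hull U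
  obtain ⟨c, rfl⟩ := ((gInj_iff hE).1 hZ W' hW').exists_extension hc b
  obtain ⟨d, hd⟩ := ((gInj_iff hE).1 hF W hW).exists_extension h (a ≫ j)
  obtain ⟨e, he⟩ := h.exists_desc (k - d ≫ c) (by
    rw [Preadditive.comp_sub, ← hab, reassoc_of% hd, sub_self])
  have : k = d ≫ c + q ≫ e := by rw [he]; abel
  rw [this]
  exact (FactorsWTriv.of_wTriv_left (hU.of_conf₂ hc hW') c).comp_left d |>.add
    ((FactorsWTriv.of_wTriv_left hW e).comp_left q)

/-- After enlarging `U` to an injective `F`, the morphism `M ⟶ F` extends to an injective hull `J`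
of `M`. Since `q ≫ k` kills `W`, the resulting `J ⟶ Z` descends to `J/W`, which is weakly trivial
and receives `Y = M/W`. -/
lemma Conf.factorsWTriv_of_deflation (hE : E.IsGorenstein) {W M Y Z : C} {j : W ⟶ M} {q : M ⟶ Y}
    (h : E.Conf j q) (hW : E.WTriv W) (hZ : E.GInj Z) {k : Y ⟶ Z}
    (hk : E.FactorsWTriv (q ≫ k)) : E.FactorsWTriv k := by
  obtain ⟨U, a, b, hU, hab⟩ := hk
  obtain ⟨F, W', l, r, hc, hW', hF⟩ := hE.exists_gInj_hull U
  obtain ⟨c, rfl⟩ := ((gInj_iff hE).1 hZ W' hW').exists_extension hc b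
  have hF' := isInjective_of_gInj_of_wTriv hE hF (hU.of_conf₂ hc hW')
  obtain ⟨J, L, m, s, hm, hJ⟩ := hE.enoughInjectives M
  obtain ⟨d, hd⟩ := hF'.exists_desc hm (a ≫ l)
  obtain ⟨K, t, y, -, ht, -, -, sq⟩ := h.exists_comp_inflation hm
  obtain ⟨e, he⟩ := ht.exists_desc (d ≫ c) (by
    rw [Category.assoc, reassoc_of% hd, hab, reassoc_of% h.1, zero_comp])
  have hK : E.WTriv K := hW.of_conf₃ ht (hE.wTriv_of_isInjective hJ)
  have := h.epi
  refine ⟨K, y, e, hK, ?_⟩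
  rw [← cancel_epi q, ← reassoc_of% sq.w, he, reassoc_of% hd, hab]

/-- The restriction of `f` to `W` factors through an injective hull `J` of `W`, and `W ⟶ J` extends
to `M`. Subtracting the composite `M ⟶ J ⟶ Z` leaves a morphism that descends to `Y`. -/
lemma Conf.exists_desc_mod (hE : E.IsGorenstein) {W M Y Z : C} {j : W ⟶ M} {q : M ⟶ Y}
    (h : E.Conf j q) (hW : E.WTriv W) (hZ : E.GInj Z) (f : M ⟶ Z) :
    ∃ g : Y ⟶ Z, E.FactorsWTriv (f - q ≫ g) := by
  obtain ⟨J, L, m, s, hm, hJ⟩ := hE.enoughInjectives W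
  have hJ' := hE.wTriv_of_isInjective hJ
  obtain ⟨t, ht⟩ := ((gInj_iff hE).1 hZ L (hW.of_conf₃ hm hJ')).exists_extension hm (j ≫ f)
  obtain ⟨d, hd⟩ := hJ.exists_desc h m
  obtain ⟨g, hg⟩ := h.exists_desc (f - d ≫ t) (by
    rw [Preadditive.comp_sub, reassoc_of% hd, ht, sub_self])
  refine ⟨g, J, d, t, hJ', ?_⟩
  rw [hg]
  abel

/-- An inflation with weakly trivial cokernel induces injections on morphisms to Gorenstein
injective objects modulo weakly trivial objects. -/
lemma Conf.cancel_inflation (hE : E.IsGorenstein) {X M W Z : C} {i : X ⟶ M} {q : M ⟶ W}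
    (h : E.Conf i q) (hW : E.WTriv W) (hZ : E.GInj Z) {g g' : M ⟶ Z}
    (hk : E.modWTriv.map (i ≫ g) = E.modWTriv.map (i ≫ g')) :
    E.modWTriv.map g = E.modWTriv.map g' := by
  rw [modWTriv_map_eq_iff] at *
  rw [← Preadditive.comp_sub] at hk
  exact h.factorsWTriv_of_inflation hE hW hZ hk

lemma Conf.cancel_deflation (hE : E.IsGorenstein) {W M Y Z : C} {j : W ⟶ M} {q : M ⟶ Y}
    (h : E.Conf j q) (hW : E.WTriv W) (hZ : E.GInj Z) {g g' : Y ⟶ Z}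
    (hk : E.modWTriv.map (q ≫ g) = E.modWTriv.map (q ≫ g')) :
    E.modWTriv.map g = E.modWTriv.map g' := by
  rw [modWTriv_map_eq_iff] at *
  rw [← Preadditive.comp_sub] at hk
  exact h.factorsWTriv_of_deflation hE hW hZ hk

lemma Conf.exists_desc_modWTriv (hE : E.IsGorenstein) {W M Y Z : C} {j : W ⟶ M} {q : M ⟶ Y}
    (h : E.Conf j q) (hW : E.WTriv W) (hZ : E.GInj Z) (f : M ⟶ Z) :
    ∃ g : Y ⟶ Z, E.modWTriv.map (q ≫ g) = E.modWTriv.map f := by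
  obtain ⟨g, hg⟩ := h.exists_desc_mod hE hW hZ f
  exact ⟨g, (modWTriv_map_eq_iff.2 hg).symm⟩

lemma Conf.cancel_inflation_right (hE : E.IsGorenstein) {X M W G : C} {i : X ⟶ M} {q : M ⟶ W}
    (h : E.Conf i q) (hW : E.WTriv W) (hG : E.GProj G) {g g' : G ⟶ X}
    (hk : E.modWTriv.map (g ≫ i) = E.modWTriv.map (g' ≫ i)) :
    E.modWTriv.map g = E.modWTriv.map g' := by
  rw [modWTriv_map_eq_iff] at *
  rw [← Preadditive.sub_comp] at hk
  exact (factorsWTriv_op_iff hE).1 (h.op.factorsWTriv_of_deflation hE.op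
    (hE.wTriv_op_iff.2 hW) ((gInj_op_iff (X := .op G) hE).2 hG) (k := (g - g').op)
    ((factorsWTriv_op_iff hE).2 hk))

lemma Conf.exists_lift_modWTriv (hE : E.IsGorenstein) {X M W G : C} {i : X ⟶ M} {q : M ⟶ W}
    (h : E.Conf i q) (hW : E.WTriv W) (hG : E.GProj G) (f : G ⟶ M) :
    ∃ g : G ⟶ X, E.modWTriv.map (g ≫ i) = E.modWTriv.map f := by
  obtain ⟨g, hg⟩ := h.op.exists_desc_mod hE.op (hE.wTriv_op_iff.2 hW)
    ((gInj_op_iff (X := .op G) hE).2 hG) f.op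
  exact ⟨g.unop, (modWTriv_map_eq_iff.2 ((factorsWTriv_op_iff hE).1 hg)).symm⟩

/-- The morphism induced between the end terms of conflations is unique modulo weakly trivial
objects, if the middle term of the second conflation is weakly trivial. -/
lemma Conf.modWTriv_map_induced {A B D B' D' : C} {i : A ⟶ B} {p : B ⟶ D} (h : E.Conf i p)
    {p' : B' ⟶ D'} (hB' : E.WTriv B') {u u' : B ⟶ B'}
    {w w' : D ⟶ D'} (hu : i ≫ u = i ≫ u') (hw : p ≫ w = u ≫ p') (hw' : p ≫ w' = u' ≫ p') :
    E.modWTriv.map w = E.modWTriv.map w' := by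
  obtain ⟨d, hd⟩ := h.exists_desc (u - u') (by rw [Preadditive.comp_sub, hu, sub_self])
  have := h.epi
  refine modWTriv_map_eq_iff.2 ⟨B', d, p', hB', ?_⟩
  rw [← cancel_epi p, reassoc_of% hd, Preadditive.sub_comp, Preadditive.comp_sub, hw, hw']

end WeaklyTrivialIdeal

/-! ### The approximation functor is an equivalence of stable categories -/

section StableComparison

variable {C : Type u} [Category.{v} C] [Preadditive C] {E : ConflationClass C}

lemma GInjApprox.conf {G : C} (a : E.GInjApprox G) : E.Conf a.η a.π := ⟨a.w, a.conflation⟩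

lemma GProjApprox.conf {Y : C} (b : E.GProjApprox Y) : E.Conf b.ι b.ε := ⟨b.w, b.conflation⟩

variable [E.IsExactCategory]

lemma IsGorenstein.nonempty_gInjApprox (hE : E.IsGorenstein) (X : C) :
    Nonempty (E.GInjApprox X) := by
  obtain ⟨F, W, j, q, h, hW, hF⟩ := hE.exists_gInj_hull X
  exact ⟨⟨F, hF⟩, W, j, q, h.1, h.2, hW⟩

lemma IsGorenstein.nonempty_gProjApprox (hE : E.IsGorenstein) (X : C) :
    Nonempty (E.GProjApprox X) := by
  obtain ⟨W, G, j, q, h, hW, hG⟩ := hE.exists_gProj_cover X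
  exact ⟨⟨G, hG⟩, W, j, q, h.1, h.2, hW⟩

lemma GInjApprox.exists_extension (hE : E.IsGorenstein) {G G' : C} (f : G ⟶ G')
    (a : E.GInjApprox G) (a' : E.GInjApprox G') : ∃ g : a.F ⟶ a'.F, a.η ≫ g.hom = f ≫ a'.η := by
  obtain ⟨g, hg⟩ := ((gInj_iff hE).1 a'.F.2 _ a.wTriv).exists_extension a.conf (f ≫ a'.η)
  exact ⟨ObjectProperty.homMk g, hg⟩

lemma GProjApprox.exists_lift (hE : E.IsGorenstein) {Y Y' : C} (g : Y ⟶ Y')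
    (b : E.GProjApprox Y) (b' : E.GProjApprox Y') :
    ∃ f : b.K ⟶ b'.K, f.hom ≫ b'.ε = b.ε ≫ g := by
  obtain ⟨f, hf⟩ := ((gProj_iff hE).1 b.K.2 _ b'.wTriv).exists_lift b'.conf (b.ε ≫ g)
  exact ⟨ObjectProperty.homMk f, hf⟩

/-- The stable category of the Gorenstein projectives embeds into the quotient by the weakly
trivial objects. -/
lemma toStable_gProj_eq_iff (hE : E.IsGorenstein) [E.gProj.IsFrobenius]
    {G G' : E.GProj.FullSubcategory} {f g : G ⟶ G'} :
    E.gProj.toStable.map f = E.gProj.toStable.map g ↔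
      E.modWTriv.map f.hom = E.modWTriv.map g.hom := by
  rw [Quotient.functor_map_eq_iff, modWTriv_map_eq_iff]
  constructor
  · rintro ⟨Q, a, b, hQ, h⟩
    exact ⟨Q.obj, a.hom, b.hom, ((hE.gProj_isFrobenius.2.1 Q).1 hQ).wTriv,
      congrArg (fun f => f.hom) h⟩
  · rintro ⟨U, a, b, hU, h⟩
    obtain ⟨K, P, i, p, hc, hP, hK⟩ := hU.exists_conf
    obtain ⟨a', rfl⟩ := ((gProj_iff hE).1 G.2 K hK).exists_lift hc a
    exact ⟨⟨P, hP.gProj hE⟩, ObjectProperty.homMk a', ObjectProperty.homMk (p ≫ b),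
      (hE.gProj_isFrobenius.2.1 _).2 hP,
      ObjectProperty.hom_ext _ ((Category.assoc _ _ _).symm.trans h)⟩

/-- The stable category of the Gorenstein injectives embeds into the quotient by the weakly
trivial objects. -/
lemma toStable_gInj_eq_iff (hE : E.IsGorenstein) [E.gInj.IsFrobenius]
    {G G' : E.GInj.FullSubcategory} {f g : G ⟶ G'} :
    E.gInj.toStable.map f = E.gInj.toStable.map g ↔
      E.modWTriv.map f.hom = E.modWTriv.map g.hom := by
  rw [Quotient.functor_map_eq_iff, modWTriv_map_eq_iff]
  constructor
  · rintro ⟨Q, a, b, hQ, h⟩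
    exact ⟨Q.obj, a.hom, b.hom, hE.wTriv_of_isInjective ((hE.gInj_isFrobenius.2.1 Q).1 hQ),
      congrArg (fun f => f.hom) h⟩
  · rintro ⟨U, a, b, hU, h⟩
    obtain ⟨J, L, i, p, hc, hJ⟩ := hE.enoughInjectives U
    obtain ⟨b', rfl⟩ := ((gInj_iff hE).1 G'.2 L
      (hU.of_conf₃ hc (hE.wTriv_of_isInjective hJ))).exists_extension hc b
    exact ⟨⟨J, hJ.gInj hE⟩, ObjectProperty.homMk (a ≫ i), ObjectProperty.homMk b',
      (hE.gInj_isFrobenius.2.1 _).2 hJ,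
      ObjectProperty.hom_ext _ ((Category.assoc _ _ _).trans h)⟩

lemma GInjApprox.cancel (hE : E.IsGorenstein) [E.gInj.IsFrobenius] {G : C} (a : E.GInjApprox G)
    {Z : E.GInj.FullSubcategory} {g g' : a.F ⟶ Z}
    (h : E.modWTriv.map (a.η ≫ g.hom) = E.modWTriv.map (a.η ≫ g'.hom)) :
    E.gInj.toStable.map g = E.gInj.toStable.map g' :=
  (toStable_gInj_eq_iff hE).2 (a.conf.cancel_inflation hE a.wTriv Z.2 h)

/-- Two approximation sequences of the same object have stably isomorphic middle terms. -/
lemma GInjApprox.exists_iso (hE : E.IsGorenstein) [E.gInj.IsFrobenius] {G : C}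
    (a a' : E.GInjApprox G) : ∃ (e : E.gInj.toStable.obj a.F ≅ E.gInj.toStable.obj a'.F)
      (g : a.F ⟶ a'.F), e.hom = E.gInj.toStable.map g ∧ a.η ≫ g.hom = a'.η := by
  obtain ⟨g, hg⟩ := exists_extension hE (𝟙 G) a a'
  obtain ⟨g', hg'⟩ := exists_extension hE (𝟙 G) a' a
  rw [Category.id_comp] at hg hg'
  refine ⟨⟨E.gInj.toStable.map g, E.gInj.toStable.map g', ?_, ?_⟩, g, rfl, hg⟩
  · rw [← Functor.map_comp, ← CategoryTheory.Functor.map_id]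
    exact a.cancel hE (by simp [reassoc_of% hg, hg'])
  · rw [← Functor.map_comp, ← CategoryTheory.Functor.map_id]
    exact a'.cancel hE (by simp [reassoc_of% hg', hg])

/-- A Gorenstein projective cover of a Gorenstein injective object `Y` is a preimage of `Y` under
the functor of approximations. -/
lemma GProjApprox.exists_iso (hE : E.IsGorenstein) [E.gInj.IsFrobenius] {Y : E.GInj.FullSubcategory}
    (b : E.GProjApprox Y.obj) (a : E.GInjApprox b.K.obj) :
    ∃ (e : E.gInj.toStable.obj a.F ≅ E.gInj.toStable.obj Y) (y : a.F ⟶ Y),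
      e.hom = E.gInj.toStable.map y ∧ a.η ≫ y.hom = b.ε := by
  obtain ⟨y, hy⟩ := ((gInj_iff hE).1 Y.2 _ a.wTriv).exists_extension a.conf b.ε
  -- The inverse need not come from a strict factorization: `b.ε ≫ z = a.η` is only obtained modulo
  -- weakly trivial objects.
  obtain ⟨z, hz⟩ := b.conf.exists_desc_modWTriv hE b.wTriv a.F.2 a.η
  refine ⟨⟨E.gInj.toStable.map (ObjectProperty.homMk y),
    E.gInj.toStable.map (ObjectProperty.homMk z), ?_, ?_⟩, ObjectProperty.homMk y, rfl, hy⟩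
  · rw [← Functor.map_comp, ← CategoryTheory.Functor.map_id]
    refine a.cancel hE ?_
    simp [reassoc_of% hy, hz]
  · rw [← Functor.map_comp, ← CategoryTheory.Functor.map_id]
    refine (toStable_gInj_eq_iff hE).2 (b.conf.cancel_deflation hE b.wTriv Y.2 ?_)
    rw [ObjectProperty.FullSubcategory.comp_hom, ← Category.assoc, Functor.map_comp,
      show E.modWTriv.map (b.ε ≫ (ObjectProperty.homMk z : Y ⟶ a.F).hom) = _ from hz,
      ← Functor.map_comp]
    exact congrArg _ (hy.trans (Category.comp_id _).symm)

variable [E.gProj.IsFrobenius] [E.gInj.IsFrobenius]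

/-- The functor on stable categories given by the middle terms of the approximation sequences
`A`. -/
noncomputable def approxFunctor (hE : E.IsGorenstein)
    (A : ∀ G : E.GProj.FullSubcategory, E.GInjApprox G.obj) :
    E.gProj.StableCategory ⥤ E.gInj.StableCategory :=
  CategoryTheory.Quotient.lift E.gProj.stableRel
    { obj := fun G => E.gInj.toStable.obj (A G).F
      map := fun {G G'} f =>
        E.gInj.toStable.map ((A G).exists_extension hE f.hom (A G')).choose
      map_id := fun G => by
        rw [← CategoryTheory.Functor.map_id]
        refine (A G).cancel hE (congrArg _ ?_)
        rw [((A G).exists_extension hE _ (A G)).choose_spec]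
        simp
      map_comp := fun {G G' G''} f g => by
        rw [← Functor.map_comp]
        refine (A G).cancel hE (congrArg _ ?_)
        rw [((A G).exists_extension hE _ (A G'')).choose_spec]
        have h := ((A G).exists_extension hE f.hom (A G')).choose_spec
        have h' := ((A G').exists_extension hE g.hom (A G'')).choose_spec
        simp [reassoc_of% h, h'] }
    (fun G G' f f' h => by
      refine (A G).cancel hE ?_
      rw [((A G).exists_extension hE f.hom (A G')).choose_spec,
        ((A G).exists_extension hE f'.hom (A G')).choose_spec, Functor.map_comp,
        Functor.map_comp, (toStable_gProj_eq_iff hE).1 (CategoryTheory.Quotient.sound _ h)])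

variable {hE : E.IsGorenstein} {A : ∀ G : E.GProj.FullSubcategory, E.GInjApprox G.obj}

/-- Commutativity is required only modulo weakly trivial objects; fullness produces squares that
commute only in this sense. -/
lemma approxFunctor_map_eq {G G' : E.GProj.FullSubcategory} {f : G ⟶ G'} {g : (A G).F ⟶ (A G').F}
    (h : E.modWTriv.map ((A G).η ≫ g.hom) = E.modWTriv.map (f.hom ≫ (A G').η)) :
    (approxFunctor hE A).map (E.gProj.toStable.map f) = E.gInj.toStable.map g := by
  refine (A G).cancel hE ?_
  rw [((A G).exists_extension hE f.hom (A G')).choose_spec, h]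

lemma exists_approxFunctor_map_eq {G G' : E.GProj.FullSubcategory} (f : G ⟶ G') :
    ∃ g : (A G).F ⟶ (A G').F, (A G).η ≫ g.hom = f.hom ≫ (A G').η ∧
      (approxFunctor hE A).map (E.gProj.toStable.map f) = E.gInj.toStable.map g := by
  obtain ⟨g, hg⟩ := (A G).exists_extension hE f.hom (A G')
  exact ⟨g, hg, approxFunctor_map_eq (by rw [hg])⟩

instance : (approxFunctor hE A).Full where
  map_surjective {X Y} ψ := by
    obtain ⟨g, rfl⟩ := E.gInj.toStable.map_surjective ψ
    obtain ⟨f, hf⟩ := (A Y.as).conf.exists_lift_modWTriv hE (A Y.as).wTriv X.as.2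
      ((A X.as).η ≫ g.hom)
    exact ⟨E.gProj.toStable.map (ObjectProperty.homMk f), approxFunctor_map_eq hf.symm⟩

instance : (approxFunctor hE A).Faithful where
  map_injective {X Y} ψ ψ' h := by
    obtain ⟨f, rfl⟩ := E.gProj.toStable.map_surjective ψ
    obtain ⟨f', rfl⟩ := E.gProj.toStable.map_surjective ψ'
    obtain ⟨g, hg, h₁⟩ := exists_approxFunctor_map_eq (hE := hE) (A := A) f
    obtain ⟨g', hg', h₂⟩ := exists_approxFunctor_map_eq (hE := hE) (A := A) f'
    refine (toStable_gProj_eq_iff hE).2 ((A Y.as).conf.cancel_inflation_right hE (A Y.as).wTriv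
      X.as.2 ?_)
    rw [← hg, ← hg', Functor.map_comp, Functor.map_comp]
    rw [(toStable_gInj_eq_iff hE).1 (h₁.symm.trans (h.trans h₂))]

lemma approxFunctor_additive : (approxFunctor hE A).Additive where
  map_add {X Y ψ ψ'} := by
    obtain ⟨f, rfl⟩ := E.gProj.toStable.map_surjective ψ
    obtain ⟨f', rfl⟩ := E.gProj.toStable.map_surjective ψ'
    obtain ⟨g, hg, h₁⟩ := exists_approxFunctor_map_eq (hE := hE) (A := A) f
    obtain ⟨g', hg', h₂⟩ := exists_approxFunctor_map_eq (hE := hE) (A := A) f'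
    rw [h₁, h₂]
    refine approxFunctor_map_eq (f := f + f') (g := g + g') (congrArg _ ?_)
    exact (Preadditive.comp_add _ _ _ _ _ _).trans ((congrArg₂ _ hg hg').trans
      (Preadditive.add_comp _ _ _ _ _ _).symm)

instance : (approxFunctor hE A).EssSurj where
  mem_essImage Y := by
    obtain ⟨b⟩ := hE.nonempty_gProjApprox Y.as.obj
    obtain ⟨e, -⟩ := b.exists_iso hE (A b.K)
    exact ⟨E.gProj.toStable.obj b.K, ⟨e⟩⟩

instance : (approxFunctor hE A).IsEquivalence where

end StableComparison

/-! ### Compatibility with suspensions and distinguished triangles -/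

section TriangleFunctor

variable {C : Type u} [Category.{v} C] [Preadditive C] {E : ConflationClass C} [E.IsExactCategory]

/-- An approximation sequence of the first term of a conflation extends to compatible approximation
sequences of its terms. -/
lemma Conf.exists_approx (hE : E.IsGorenstein) {X Y Z : C} {i : X ⟶ Y} {p : Y ⟶ Z}
    (h : E.Conf i p) (a : E.GInjApprox X) :
    ∃ (b : E.GInjApprox Y) (c : E.GInjApprox Z) (i' : a.F ⟶ b.F) (p' : b.F ⟶ c.F),
      E.gInj.Conf i' p' ∧ i ≫ b.η = a.η ≫ i'.hom ∧ p ≫ c.η = b.η ≫ p'.hom := by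
  -- Push the conflation out to `a.F`, then embed the middle term `N` into a Gorenstein injective
  -- `F`. The quotient `F/a.F` is Gorenstein injective, contains `Z` with cokernel `W`, and `F/Y` is
  -- an extension of `W` by `a.W`.
  obtain ⟨N, n, j, q, sq, hj, hq⟩ := h.exists_pushout a.η
  obtain ⟨d, hd, -⟩ := a.conf.of_isPushout sq.flip
  obtain ⟨F, W, y, r, hy, hW, hF⟩ := hE.exists_gInj_hull N
  obtain ⟨V, s, c, t, hs, hc, -⟩ := hd.exists_comp_inflation hy
  obtain ⟨Z', s', c', t', hs', hc', -, sq'⟩ := hj.exists_comp_inflation hy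
  exact ⟨⟨⟨F, hF⟩, V, n ≫ y, s, hs.1, hs.2, a.wTriv.of_conf₂ hc hW⟩,
    ⟨⟨Z', gInj_of_conf₃ hE hs' a.F.2 hF⟩, W, c', t', hc'.1, hc'.2, hW⟩,
    ObjectProperty.homMk (j ≫ y), ObjectProperty.homMk s', conf_restrict_iff.2 hs',
    by simp [reassoc_of% sq.w], by simp [← hq, ← sq'.w]⟩

variable [E.gInj.IsFrobenius]

/-- Two conflations with injective middle terms and the same first term have stably isomorphic end
terms. -/
lemma exists_iso_of_isInjective (hE : E.IsGorenstein) {X J K Z T : E.GInj.FullSubcategory}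
    {i : X ⟶ J} {p : J ⟶ Z} (h : E.gInj.Conf i p) (hJ : E.gInj.IsInjective J) {i' : X ⟶ K}
    {p' : K ⟶ T} (h' : E.gInj.Conf i' p') (hK : E.gInj.IsInjective K) :
    ∃ (e : E.gInj.toStable.obj Z ≅ E.gInj.toStable.obj T) (u : J ⟶ K) (v : Z ⟶ T),
      e.hom = E.gInj.toStable.map v ∧ i ≫ u = i' ∧ p ≫ v = u ≫ p' := by
  have hJ' := hE.wTriv_of_isInjective ((hE.gInj_isFrobenius.2.2 J).1 hJ)
  have hK' := hE.wTriv_of_isInjective ((hE.gInj_isFrobenius.2.2 K).1 hK)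
  obtain ⟨u, hu⟩ := hK.exists_desc h i'
  obtain ⟨u', hu'⟩ := hJ.exists_desc h' i
  obtain ⟨v, hv⟩ := h.exists_desc (u ≫ p') (by rw [reassoc_of% hu, h'.1])
  obtain ⟨v', hv'⟩ := h'.exists_desc (u' ≫ p) (by rw [reassoc_of% hu', h.1])
  refine ⟨⟨E.gInj.toStable.map v, E.gInj.toStable.map v', ?_, ?_⟩, u, v, rfl, hu, hv⟩
  · rw [← Functor.map_comp, ← CategoryTheory.Functor.map_id]
    refine (toStable_gInj_eq_iff hE).2 ((conf_restrict_iff.1 h).modWTriv_map_induced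
      (p' := p.hom) hJ' (u := (u ≫ u').hom) (u' := 𝟙 _) ?_ ?_ ?_)
    · exact congrArg (fun f => f.hom) (show i ≫ u ≫ u' = i ≫ 𝟙 _ by rw [reassoc_of% hu]; simp [hu'])
    · exact congrArg (fun f => f.hom) (show p ≫ v ≫ v' = (u ≫ u') ≫ p by
        rw [reassoc_of% hv, hv', Category.assoc])
    · simp
  · rw [← Functor.map_comp, ← CategoryTheory.Functor.map_id]
    refine (toStable_gInj_eq_iff hE).2 ((conf_restrict_iff.1 h').modWTriv_map_induced
      (p' := p'.hom) hK' (u := (u' ≫ u).hom) (u' := 𝟙 _) ?_ ?_ ?_)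
    · exact congrArg (fun f => f.hom) (show i' ≫ u' ≫ u = i' ≫ 𝟙 _ by rw [reassoc_of% hu']; simp [hu])
    · exact congrArg (fun f => f.hom) (show p' ≫ v' ≫ v = (u' ≫ u) ≫ p' by
        rw [reassoc_of% hv', hv, Category.assoc])
    · simp

/-- The morphism `t` between the approximation of the suspension of `G` and the suspension of the
approximation of `G` is compatible with a morphism of the conflations defining the suspensions. -/
def SuspensionCompatible (S : E.gProj.SuspensionData) (S' : E.gInj.SuspensionData)
    (A : ∀ G : E.GProj.FullSubcategory, E.GInjApprox G.obj) (G : E.GProj.FullSubcategory)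
    (t : (A (S.T G)).F ⟶ S'.T (A G).F) : Prop :=
  ∃ (u : (S.I G).obj ⟶ (S'.I (A G).F).obj) (τ : (S.T G).obj ⟶ (S'.T (A G).F).obj),
    (S.i G).hom ≫ u = (A G).η ≫ (S'.i (A G).F).hom ∧
    (S.p G).hom ≫ τ = u ≫ (S'.p (A G).F).hom ∧
    E.modWTriv.map ((A (S.T G)).η ≫ t.hom) = E.modWTriv.map τ

variable (S : E.gProj.SuspensionData) (S' : E.gInj.SuspensionData) {hE : E.IsGorenstein}
  {A : ∀ G : E.GProj.FullSubcategory, E.GInjApprox G.obj}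

/-- Approximating `G ⟶ I G ⟶ T G` compatibly gives a conflation starting at `F(G)` whose middle term
is Gorenstein injective and weakly trivial, hence injective. Its end term is thus both an
approximation of `T G` and a suspension of `F(G)`. -/
lemma exists_suspension_iso (hE : E.IsGorenstein) (G : E.GProj.FullSubcategory) :
    ∃ (e : E.gInj.toStable.obj (A (S.T G)).F ≅ E.gInj.toStable.obj (S'.T (A G).F))
      (t : (A (S.T G)).F ⟶ S'.T (A G).F), e.hom = E.gInj.toStable.map t ∧
        SuspensionCompatible S S' A G t := by
  have hc := conf_of_conflation (S.conflation G)
  have hc' := conf_of_conflation (S'.conflation (A G).F)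
  obtain ⟨b, c, i', p', h, hi, hp⟩ := (conf_restrict_iff.1 hc).exists_approx hE (A G)
  have hb : E.WTriv b.F.obj := (((hE.gProj_isFrobenius.2.2 _).1 (S.injective G)).wTriv).of_conf₂
    b.conf b.wTriv
  obtain ⟨e, u, v, he, hu, hv⟩ := exists_iso_of_isInjective hE h
    ((hE.gInj_isFrobenius.2.2 _).2 (isInjective_of_gInj_of_wTriv hE b.F.2 hb)) hc'
    (S'.injective (A G).F)
  obtain ⟨e', g, he', hg⟩ := (A (S.T G)).exists_iso hE c
  refine ⟨e' ≪≫ e, g ≫ v, by simp [he, he'], b.η ≫ u.hom, c.η ≫ v.hom, ?_, ?_, ?_⟩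
  · have hu' : i'.hom ≫ u.hom = (S'.i (A G).F).hom := congrArg (fun f => f.hom) hu
    have hi' : (S.i G).hom ≫ b.η = (A G).η ≫ i'.hom := hi
    rw [reassoc_of% hi', hu']
  · have hv' : p'.hom ≫ v.hom = u.hom ≫ (S'.p (A G).F).hom := congrArg (fun f => f.hom) hv
    have hp' : (S.p G).hom ≫ c.η = b.η ≫ p'.hom := hp
    rw [reassoc_of% hp', hv', Category.assoc]
  · rw [ObjectProperty.FullSubcategory.comp_hom, reassoc_of% hg]

variable [E.gProj.IsFrobenius]

/-- The isomorphism comparing the suspension functors. -/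
noncomputable def suspensionIso (hE : E.IsGorenstein)
    (A : ∀ G : E.GProj.FullSubcategory, E.GInjApprox G.obj) :
    S.suspension ⋙ approxFunctor hE A ≅ approxFunctor hE A ⋙ S'.suspension :=
  NatIso.ofComponents (fun X => (exists_suspension_iso S S' hE X.as).choose) (by
    intro X Y ψ
    obtain ⟨f, rfl⟩ := E.gProj.toStable.map_surjective ψ
    obtain ⟨t, ht, u, τ, hu, hτ, htτ⟩ := (exists_suspension_iso (A := A) S S' hE X.as).choose_spec
    obtain ⟨t', ht', u', τ', hu', hτ', htτ'⟩ :=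
      (exists_suspension_iso (A := A) S S' hE Y.as).choose_spec
    obtain ⟨v, hv⟩ := S.exists_induces f
    obtain ⟨g, hg, hgf⟩ := exists_approxFunctor_map_eq (hE := hE) (A := A) f
    obtain ⟨w, hw⟩ := S'.exists_induces g
    obtain ⟨v', hv', hvv'⟩ := exists_approxFunctor_map_eq (hE := hE) (A := A) v
    have h₁ : (approxFunctor hE A).map (S.suspension.map (E.gProj.toStable.map f)) =
        E.gInj.toStable.map v' :=
      (congrArg (approxFunctor hE A).map (S.suspension_map_eq f v hv)).trans hvv'
    have h₂ : S'.suspension.map ((approxFunctor hE A).map (E.gProj.toStable.map f)) =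
        E.gInj.toStable.map w :=
      (congrArg S'.suspension.map hgf).trans (S'.suspension_map_eq g w hw)
    refine (congrArg₂ (fun a b => a ≫ b) h₁ ht').trans
      (Eq.trans ?_ (congrArg₂ (fun a b => a ≫ b) ht h₂).symm)
    refine Eq.trans (E.gInj.toStable.map_comp _ _).symm
      (Eq.trans ?_ (E.gInj.toStable.map_comp _ _))
    refine (A (S.T X.as)).cancel hE ?_
    obtain ⟨k, hk, hkv⟩ := hv
    obtain ⟨l, hl, hlw⟩ := hw
    replace hk := congrArg (fun f => f.hom) hk
    replace hkv := congrArg (fun f => f.hom) hkv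
    replace hl := congrArg (fun f => f.hom) hl
    replace hlw := congrArg (fun f => f.hom) hlw
    simp only [ObjectProperty.FullSubcategory.comp_hom] at hk hkv hl hlw
    show E.modWTriv.map ((A (S.T X.as)).η ≫ v'.hom ≫ t'.hom) =
      E.modWTriv.map ((A (S.T X.as)).η ≫ t.hom ≫ w.hom)
    rw [reassoc_of% hv', ← Category.assoc (A (S.T X.as)).η, Functor.map_comp, htτ',
      Functor.map_comp _ (_ ≫ _), htτ, ← Functor.map_comp, ← Functor.map_comp]
    -- Both composites are end components of morphisms between the two suspension conflations with
    -- the same first component. The target's middle term is injective, so they agree modulo weakly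
    -- trivial objects.
    refine (conf_restrict_iff.1 (conf_of_conflation (S.conflation X.as))).modWTriv_map_induced
      (p' := (S'.p (A Y.as).F).hom) (u := k.hom ≫ u') (u' := u ≫ l.hom)
      (hE.wTriv_of_isInjective ((hE.gInj_isFrobenius.2.2 _).1 (S'.injective _))) ?_ ?_ ?_
    · show (S.i X.as).hom ≫ k.hom ≫ u' = (S.i X.as).hom ≫ u ≫ l.hom
      rw [reassoc_of% hk, hu', reassoc_of% hu, hl, reassoc_of% hg]
    · show (S.p X.as).hom ≫ v.hom ≫ τ' = (k.hom ≫ u') ≫ _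
      rw [reassoc_of% hkv, hτ', Category.assoc]
    · show (S.p X.as).hom ≫ τ ≫ w.hom = (u ≫ l.hom) ≫ _
      rw [reassoc_of% hτ, hlw, Category.assoc])

lemma suspensionIso_compatible (hE : E.IsGorenstein) (G : E.GProj.FullSubcategory) :
    ∃ t : (A (S.T G)).F ⟶ S'.T (A G).F,
      (suspensionIso S S' hE A).hom.app (E.gProj.toStable.obj G) = E.gInj.toStable.map t ∧
      SuspensionCompatible S S' A G t :=
  (exists_suspension_iso S S' hE G).choose_spec

/-- The standard triangle of a conflation goes to that of its compatible approximation. The square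
with the connecting morphisms commutes by uniqueness of induced morphisms modulo weakly trivial
objects. -/
lemma distinguished_of_conf {K : ShortComplex E.GProj.FullSubcategory}
    (hK : E.gProj.Conflation K) {u : K.X₂ ⟶ S.I K.X₁} {v : K.X₃ ⟶ S.T K.X₁}
    (hu : K.f ≫ u = S.i K.X₁) (hv : K.g ≫ v = u ≫ S.p K.X₁) :
    ∃ (K' : ShortComplex E.GInj.FullSubcategory) (u' : K'.X₂ ⟶ S'.I K'.X₁)
      (v' : K'.X₃ ⟶ S'.T K'.X₁)
      (eA : (approxFunctor hE A).obj (E.gProj.toStable.obj K.X₁) ≅ E.gInj.toStable.obj K'.X₁)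
      (eB : (approxFunctor hE A).obj (E.gProj.toStable.obj K.X₂) ≅ E.gInj.toStable.obj K'.X₂)
      (eD : (approxFunctor hE A).obj (E.gProj.toStable.obj K.X₃) ≅ E.gInj.toStable.obj K'.X₃),
      E.gInj.Conflation K' ∧ K'.f ≫ u' = S'.i K'.X₁ ∧ K'.g ≫ v' = u' ≫ S'.p K'.X₁ ∧
      (approxFunctor hE A).map (E.gProj.toStable.map K.f) ≫ eB.hom =
        eA.hom ≫ E.gInj.toStable.map K'.f ∧
      (approxFunctor hE A).map (E.gProj.toStable.map K.g) ≫ eD.hom =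
        eB.hom ≫ E.gInj.toStable.map K'.g ∧
      ((approxFunctor hE A).map (E.gProj.toStable.map v) ≫
        (suspensionIso S S' hE A).hom.app (E.gProj.toStable.obj K.X₁)) ≫
          S'.suspension.map eA.hom = eD.hom ≫ E.gInj.toStable.map v' := by
  have hc := conf_of_conflation hK
  obtain ⟨b, c, i', p', h, hi, hp⟩ := (conf_restrict_iff.1 hc).exists_approx hE (A K.X₁)
  obtain ⟨u', hu'⟩ := (S'.injective (A K.X₁).F).exists_desc h (S'.i (A K.X₁).F)
  obtain ⟨v', hv'⟩ := h.exists_desc (u' ≫ S'.p (A K.X₁).F) (by rw [reassoc_of% hu', S'.w])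
  obtain ⟨eB, y, heB, hy⟩ := (A K.X₂).exists_iso hE b
  obtain ⟨eD, z, heD, hz⟩ := (A K.X₃).exists_iso hE c
  obtain ⟨t, ht, k, τ, hk, hτ, htτ⟩ := suspensionIso_compatible (A := A) S S' hE K.X₁
  obtain ⟨f', hf', hf⟩ := exists_approxFunctor_map_eq (hE := hE) (A := A) K.f
  obtain ⟨g', hg', hg⟩ := exists_approxFunctor_map_eq (hE := hE) (A := A) K.g
  obtain ⟨w, hw, hvw⟩ := exists_approxFunctor_map_eq (hE := hE) (A := A) v
  refine ⟨ShortComplex.mk i' p' h.1, u', v', Iso.refl _, eB, eD, h.2, hu', hv', ?_, ?_, ?_⟩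
  · rw [hf, heB, Iso.refl_hom]
    refine Eq.trans (E.gInj.toStable.map_comp _ _).symm (Eq.trans ?_ (Category.id_comp _).symm)
    refine (A K.X₁).cancel hE (congrArg _ ?_)
    rw [ObjectProperty.FullSubcategory.comp_hom, reassoc_of% hf', hy]
    exact hi
  · rw [hg, heB, heD]
    refine Eq.trans (E.gInj.toStable.map_comp _ _).symm
      (Eq.trans ?_ (E.gInj.toStable.map_comp _ _))
    refine (A K.X₂).cancel hE (congrArg _ ?_)
    rw [ObjectProperty.FullSubcategory.comp_hom, ObjectProperty.FullSubcategory.comp_hom,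
      reassoc_of% hg', hz, reassoc_of% hy]
    exact hp
  · rw [hvw, ht, heD, Iso.refl_hom]
    have := S'.suspension.map_id (E.gInj.toStable.obj (A K.X₁).F)
    refine Eq.trans (congrArg _ this) (Eq.trans (Category.comp_id _) ?_)
    refine Eq.trans (E.gInj.toStable.map_comp _ _).symm
      (Eq.trans ?_ (E.gInj.toStable.map_comp _ _))
    refine (A K.X₃).cancel hE ?_
    show E.modWTriv.map ((A K.X₃).η ≫ w.hom ≫ t.hom) =
      E.modWTriv.map ((A K.X₃).η ≫ z.hom ≫ v'.hom)
    rw [reassoc_of% hw, reassoc_of% hz, Functor.map_comp, htτ, ← Functor.map_comp]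
    replace hu := congrArg (fun f => f.hom) hu
    replace hv := congrArg (fun f => f.hom) hv
    replace hu' := congrArg (fun f => f.hom) hu'
    replace hv' := congrArg (fun f => f.hom) hv'
    replace hi : K.f.hom ≫ b.η = _ := hi
    replace hp : K.g.hom ≫ c.η = _ := hp
    simp only [ObjectProperty.FullSubcategory.comp_hom] at hu hv hu' hv'
    refine (conf_restrict_iff.1 hc).modWTriv_map_induced
      (p' := (S'.p (A K.X₁).F).hom) (u := u.hom ≫ k) (u' := b.η ≫ u'.hom)
      (hE.wTriv_of_isInjective ((hE.gInj_isFrobenius.2.2 _).1 (S'.injective _))) ?_ ?_ ?_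
    · rw [reassoc_of% hu, hk, reassoc_of% hi, hu']
    · rw [reassoc_of% hv, hτ, Category.assoc]
    · rw [reassoc_of% hp, hv', Category.assoc]

lemma approxFunctor_isTriangleFunctor : IsTriangleFunctor S S' (approxFunctor hE A) := by
  refine ⟨approxFunctor_additive, suspensionIso S S' hE A, ?_⟩
  rintro X Y Z a b c ⟨K, u, v, eA, eB, eD, hK, hu, hv, ha, hb, hc⟩
  obtain ⟨K', u', v', eA', eB', eD', hK', hu', hv', hf, hg, ht⟩ :=
    distinguished_of_conf (hE := hE) (A := A) S S' hK hu hv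
  refine ⟨K', u', v', (approxFunctor hE A).mapIso eA ≪≫ eA', (approxFunctor hE A).mapIso eB ≪≫ eB',
    (approxFunctor hE A).mapIso eD ≪≫ eD', hK', hu', hv', ?_, ?_, ?_⟩
  · simp only [Iso.trans_hom, Functor.mapIso_hom, ← Functor.map_comp_assoc, ha, Category.assoc]
    rw [Functor.map_comp_assoc, hf]
  · simp only [Iso.trans_hom, Functor.mapIso_hom, ← Functor.map_comp_assoc, hb, Category.assoc]
    rw [Functor.map_comp_assoc, hg]
  -- `S.T` and the suspension of the class agree only definitionally; naming the morphisms with the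
  -- suspension as target makes rewriting possible.
  · obtain ⟨w, hw⟩ : ∃ w : E.gProj.toStable.obj K.X₃ ⟶
        S.suspension.obj (E.gProj.toStable.obj K.X₁), w = E.gProj.toStable.map v := ⟨_, rfl⟩
    obtain ⟨w', hw'⟩ : ∃ w' : E.gInj.toStable.obj K'.X₃ ⟶
        S'.suspension.obj (E.gInj.toStable.obj K'.X₁), w' = E.gInj.toStable.map v' := ⟨_, rfl⟩
    replace hc : c ≫ S.suspension.map eA.hom = eD.hom ≫ w := by subst hw; exact hc
    replace ht : ((approxFunctor hE A).map w ≫ (suspensionIso S S' hE A).hom.app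
        (E.gProj.toStable.obj K.X₁)) ≫ S'.suspension.map eA'.hom = eD'.hom ≫ w' := by
      subst hw hw'; exact ht
    have := (suspensionIso S S' hE A).hom.naturality eA.hom
    suffices ((approxFunctor hE A).map c ≫ (suspensionIso S S' hE A).hom.app X) ≫
        S'.suspension.map ((approxFunctor hE A).mapIso eA ≪≫ eA').hom =
        ((approxFunctor hE A).mapIso eD ≪≫ eD').hom ≫ w' by subst hw'; exact this
    simp only [Functor.comp_map] at this
    rw [Iso.trans_hom, Iso.trans_hom, Functor.mapIso_hom, Functor.mapIso_hom, Functor.map_comp,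
      Category.assoc, ← reassoc_of% this, ← Functor.map_comp_assoc, hc, Functor.map_comp,
      Category.assoc, Category.assoc]
    rw [Category.assoc] at ht
    rw [ht]

end TriangleFunctor

/-! ### Transport of naturality to the inverse equivalence -/

section Equivalence

variable {D : Type*} [Category* D] {D' : Type*} [Category* D'] (Φ : D ≌ D')

/-- An isomorphism `Φ X ≅ Y` gives an isomorphism of `X` with the image of `Y` under the inverse
of `Φ`. -/
def inverseObjIso {X : D} {Y : D'} (e : Φ.functor.obj X ≅ Y) : Φ.inverse.obj Y ≅ X :=
  Φ.inverse.mapIso e.symm ≪≫ (Φ.unitIso.app X).symm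

lemma inverse_map_comp_iso {X X' : D} {Y Y' : D'} (e : Φ.functor.obj X ≅ Y)
    (e' : Φ.functor.obj X' ≅ Y') (f : X ⟶ X') (g : Y ⟶ Y')
    (h : Φ.functor.map f ≫ e'.hom = e.hom ≫ g) :
    Φ.inverse.map g ≫ (inverseObjIso Φ e').hom = (inverseObjIso Φ e).hom ≫ f := by
  have h' : g ≫ e'.inv = e.inv ≫ Φ.functor.map f := by
    rw [Iso.comp_inv_eq, Category.assoc, h, Iso.inv_hom_id_assoc]
  simp [inverseObjIso, ← Functor.map_comp_assoc, h']

end Equivalence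

end ConflationClass

open ConflationClass

theorem propositionA6 {C : Type u} [Category.{v} C] [Preadditive C] (E : ConflationClass C)
    [E.IsExactCategory] (hE : E.IsGorenstein) :
    -- the categories of Gorenstein projectives and Gorenstein injectives are Frobenius exact
    ∃ (_ : E.gProj.IsFrobenius) (_ : E.gInj.IsFrobenius),
      -- approximation sequences exist, and morphisms extend, respectively lift, along them
      (∀ G : E.GProj.FullSubcategory, Nonempty (E.GInjApprox G.obj)) ∧
      (∀ Y : E.GInj.FullSubcategory, Nonempty (E.GProjApprox Y.obj)) ∧
      (∀ (G G' : E.GProj.FullSubcategory) (f : G ⟶ G') (a : E.GInjApprox G.obj)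
        (a' : E.GInjApprox G'.obj), ∃ g : a.F ⟶ a'.F, a.η ≫ g.hom = f.hom ≫ a'.η) ∧
      (∀ (Y Y' : E.GInj.FullSubcategory) (g : Y ⟶ Y') (b : E.GProjApprox Y.obj)
        (b' : E.GProjApprox Y'.obj), ∃ f : b.K ⟶ b'.K, f.hom ≫ b'.ε = b.ε ≫ g.hom) ∧
      ∃ Φ : E.gProj.StableCategory ≌ E.gInj.StableCategory,
        -- a triangle equivalence, for all choices of the suspension functors
        (∀ (S : E.gProj.SuspensionData) (S' : E.gInj.SuspensionData),
          ConflationClass.IsTriangleFunctor S S' Φ.functor) ∧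
        -- `Φ` is given by the middle terms of approximation sequences, whichever are chosen
        (∃ e : ∀ (G : E.GProj.FullSubcategory) (a : E.GInjApprox G.obj),
            Φ.functor.obj (E.gProj.toStable.obj G) ≅ E.gInj.toStable.obj a.F,
          ∀ (G G' : E.GProj.FullSubcategory) (f : G ⟶ G') (a : E.GInjApprox G.obj)
            (a' : E.GInjApprox G'.obj) (g : a.F ⟶ a'.F), a.η ≫ g.hom = f.hom ≫ a'.η →
            Φ.functor.map (E.gProj.toStable.map f) ≫ (e G' a').hom =
              (e G a).hom ≫ E.gInj.toStable.map g) ∧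
        -- dually for the inverse of `Φ`
        (∃ e : ∀ (Y : E.GInj.FullSubcategory) (b : E.GProjApprox Y.obj),
            Φ.inverse.obj (E.gInj.toStable.obj Y) ≅ E.gProj.toStable.obj b.K,
          ∀ (Y Y' : E.GInj.FullSubcategory) (g : Y ⟶ Y') (b : E.GProjApprox Y.obj)
            (b' : E.GProjApprox Y'.obj) (f : b.K ⟶ b'.K), f.hom ≫ b'.ε = b.ε ≫ g.hom →
            Φ.inverse.map (E.gInj.toStable.map g) ≫ (e Y' b').hom =
              (e Y b).hom ≫ E.gProj.toStable.map f) := by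
  obtain ⟨hP, -⟩ := hE.gProj_isFrobenius
  obtain ⟨hI, -⟩ := hE.gInj_isFrobenius
  let A : ∀ G : E.GProj.FullSubcategory, E.GInjApprox G.obj :=
    fun G => (hE.nonempty_gInjApprox G.obj).some
  refine ⟨hP, hI, fun G => hE.nonempty_gInjApprox _, fun Y => hE.nonempty_gProjApprox _,
    fun G G' f a a' => a.exists_extension hE f.hom a',
    fun Y Y' g b b' => b.exists_lift hE g.hom b', (approxFunctor hE A).asEquivalence,
    fun S S' => approxFunctor_isTriangleFunctor (hE := hE) (A := A) S S', ?_, ?_⟩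
  -- The functor uses the fixed choice `A`; any other approximation is compared with it by a
  -- morphism under `G`, unique in the stable category.
  · choose e y he hy using fun (G : E.GProj.FullSubcategory) (a : E.GInjApprox G.obj) =>
      (A G).exists_iso hE a
    refine ⟨e, fun G G' f a a' g h => ?_⟩
    obtain ⟨k, hk, hkf⟩ := exists_approxFunctor_map_eq (hE := hE) (A := A) f
    refine Eq.trans (congrArg₂ (fun a b => a ≫ b) hkf (he _ _)) ?_
    rw [he]
    refine Eq.trans (E.gInj.toStable.map_comp _ _).symm
      (Eq.trans ?_ (E.gInj.toStable.map_comp _ _))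
    refine (A G).cancel hE (congrArg _ ?_)
    rw [ObjectProperty.FullSubcategory.comp_hom, ObjectProperty.FullSubcategory.comp_hom,
      reassoc_of% hk, hy, reassoc_of% hy, h]
  · choose e y he hy using fun (Y : E.GInj.FullSubcategory) (b : E.GProjApprox Y.obj) =>
      b.exists_iso hE (A b.K)
    let Φ := (approxFunctor hE A).asEquivalence
    refine ⟨fun Y b => inverseObjIso Φ (X := E.gProj.toStable.obj b.K) (e Y b), fun Y Y' g b b' f h => ?_⟩
    obtain ⟨k, hk, hkf⟩ := exists_approxFunctor_map_eq (hE := hE) (A := A) f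
    -- Naturality is first proved for `F(K(Y)) ≅ Y`, where it can be tested after `η`, and then
    -- carried over to the inverse.
    have key : Φ.functor.map (E.gProj.toStable.map f) ≫ (e Y' b').hom =
        (e Y b).hom ≫ E.gInj.toStable.map g := by
      refine Eq.trans (congrArg₂ (fun a b => a ≫ b) hkf (he _ _)) ?_
      rw [he]
      refine Eq.trans (E.gInj.toStable.map_comp _ _).symm
        (Eq.trans ?_ (E.gInj.toStable.map_comp _ _))
      refine (A b.K).cancel hE (congrArg _ ?_)
      rw [ObjectProperty.FullSubcategory.comp_hom, ObjectProperty.FullSubcategory.comp_hom,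
        reassoc_of% hk, hy, reassoc_of% hy, h]
    exact inverse_map_comp_iso Φ (X := E.gProj.toStable.obj b.K)
      (X' := E.gProj.toStable.obj b'.K) (e Y b) (e Y' b') _ _ key
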